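/- Let $d\in\mathbb N$, $\Omega=(0,1)$ with Lebesgue measure, and $\mathbb H=L^2(\Omega;\mathbb R^d)$. Let $L\in C^3(\mathbb R^d\times\mathbb R^d)$, and let $c_0,c_1,\lambda_0>0$ and $C_L\in\mathbb R$ be such that $c_0|v|^2\le L(q,v)$, $|\nabla_qL(q,v)|\le c_1$ for all $q,v$, and, for all $q_0,q_1,v_0,v_1\in\mathbb R^d$ and $\varepsilon\in[0,1]$, $$\lambda_0|v_1-v_0|^2\le\frac{d^2}{d\varepsilon^2}L\big((1-\varepsilon)q_0+\varepsilon q_1,(1-\varepsilon)v_0+\varepsilon v_1\big)\le C_L\big(|q_1-q_0|^2+|v_1-v_0|^2\big).$$ Let $\Phi,\Psi\in C^3(\mathbb R^d)$ be even, bounded from below, with bounded first, second and third derivatives, and let $c_\Phi,c_\Psi\in\mathbb R$ satisfy $c_\Phi I_d\le\nabla^2\Phi$ and $c_\Psi I_d\le\nabla^2\Psi$. Write $c^-=\max\{-c,0\}$ and let $\|\nabla^2\Phi\|_{L^\infty}$ be the supremum of the operator norm of the Hessian. Let $T>0$ satisfy $$T^2\big(c_\Phi^-+2\|\nabla^2\Phi\|_{L^\infty}\big)+T\big(c_\Psi^-+2\|\nabla^2\Psi\|_{L^\infty}\big)<\frac{\lambda_0}2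 .$$ Set $$\hat L(X,V)=\int_\Omega L(X(\omega),V(\omega))\,d\omega+\frac12\int_{\Omega^2}\Phi(X(\omega)-X(\tilde\omega))\,d\omega d\tilde\omega,\qquad \mathcal U_*(X)=\frac12\int_{\Omega^2}\Psi(X(\omega)-X(\tilde\omega))\,d\omega d\tilde\omega .$$ For $t\in[0,T]$ let $AC_2(0,t;\mathbb H)$ be the set of absolutely continuous curves $\gamma:[0,t]\to\mathbb H$ with $\int_0^t\|\dot\gamma(s)\|^2_{\mathbb H}\,ds<\infty$, and for $X\in\mathbb H$ let $$\hat U(t,X)=\inf\Big\{\int_0^t\hat L(\gamma(s),\dot\gamma(s))\,ds+\mathcal U_*(\gamma(0)):\ \gamma\in AC_2(0,t;\mathbb H),\ \gamma(t)=X\Big\}.$$ Then: 1. For all $t\in[0,T]$ and $X\in\mathbb H$ the function $\hat U(t,\cdot)$ is Fréchet differentiable at $X$, and its gradient $(t,X)\mapsto\nabla_X\hat U(t,X)\in\mathbb H$ is (jointly) continuous on $[0,T]\times\mathbb H$. 2. For $t\in(0,T]$ put $C_t=\frac t3\big(C_L+\|\nabla^2\Phi\|_{L^\infty}\big)+\frac1tC_L$.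 Then $-2(tc_\Phi^-+c_\Psi^-)\le\nabla_{XX}\hat U(t,\cdot)\le C_t$, in the sense that for all $X,h\in\mathbb H$ $$-2\,(t\,c_\Phi^-+c_\Psi^-)\,\|h\|^2\le\hat U(t,X+h)+\hat U(t,X-h)-2\hat U(t,X)\le C_t\|h\|^2$$ (so the lower bound is $0$ if $c_\Phi,c_\Psi\ge0$), and $\nabla_X\hat U(t,\cdot)$ is $C_t$-Lipschitz on $\mathbb H$. 3. For $t\in(0,T]$ and $X\in\mathbb H$ the infimum defining $\hat U(t,X)$ is attained, and every minimizer $\gamma$ has a one-sided derivative $\dot\gamma(t)\in\mathbb H$ at the endpoint $t$, with $$\nabla_X\hat U(t,\gamma(t))(\omega)=\nabla_vL\big(\gamma(t)(\omega),\dot\gamma(t)(\omega)\big)\quad\text{for a.e. }\omega\in\Omega .$$ -/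

import Mathlib

open MeasureTheory Set
open scoped Interval

noncomputable section

namespace MeanField

/-- The state space of a single player, `ℝᵈ` with its Euclidean norm. -/
abbrev E (d : ℕ) : Type := EuclideanSpace ℝ (Fin d)

/-- Lebesgue measure on the set of labels `Ω = (0,1)`. -/
abbrev labels : Measure ℝ := volume.restrict (Ioo (0 : ℝ) 1)

/-- The Hilbert space `ℍ = L²((0,1); ℝᵈ)`. -/
abbrev HS (d : ℕ) : Type := Lp (E d) 2 labels

/-- `½ ∫∫ Φ(X(ω) - X(ω')) dω dω'`: the interaction part of the running cost, and, with `Ψ` in place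
of `Φ`, the initial cost functional `𝒰_*`. -/
def interactionCost {d : ℕ} (Φ : E d → ℝ) (X : HS d) : ℝ :=
  (1 / 2) * ∫ ω, (∫ ω', Φ (X ω - X ω') ∂labels) ∂labels

/-- The running cost `L̂(X, V) = ∫ L(X(ω), V(ω)) dω + ½ ∫∫ Φ(X(ω) - X(ω')) dω dω'`. -/
def runningCost {d : ℕ} (L : E d × E d → ℝ) (Φ : E d → ℝ) (X V : HS d) : ℝ :=
  (∫ ω, L (X ω, V ω) ∂labels) + interactionCost Φ X

/-- `γ ∈ AC₂(0,t; ℍ)`: on `[0,t]` the curve `γ` is the integral of a square-integrable velocity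
(which then is the derivative of `γ` almost everywhere on `(0,t)`). -/
def AC2 {d : ℕ} (t : ℝ) (γ : ℝ → HS d) : Prop :=
  ∃ v : ℝ → HS d, MemLp v 2 (volume.restrict (Ioc 0 t)) ∧
    ∀ s ∈ Icc 0 t, γ s = γ 0 + ∫ r in (0 : ℝ)..s, v r

/-- The total cost `∫₀ᵗ L̂(γ(s), γ'(s)) ds + 𝒰_*(γ(0))` of a curve. -/
def totalCost {d : ℕ} (L : E d × E d → ℝ) (Φ Ψ : E d → ℝ) (t : ℝ) (γ : ℝ → HS d) : ℝ :=
  (∫ s in (0 : ℝ)..t, runningCost L Φ (γ s) (deriv γ s)) + interactionCost Ψ (γ 0)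

/-- The value function `Û(t, X)`. -/
def Uhat {d : ℕ} (L : E d × E d → ℝ) (Φ Ψ : E d → ℝ) (t : ℝ) (X : HS d) : ℝ :=
  sInf {c : ℝ | ∃ γ : ℝ → HS d, AC2 t γ ∧ γ t = X ∧ c = totalCost L Φ Ψ t γ}

/-- `γ` is a minimizer achieving `Û(t, X)`. -/
def IsMinimizer {d : ℕ} (L : E d × E d → ℝ) (Φ Ψ : E d → ℝ) (t : ℝ) (X : HS d)
    (γ : ℝ → HS d) : Prop :=
  AC2 t γ ∧ γ t = X ∧ totalCost L Φ Ψ t γ = Uhat L Φ Ψ t X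

/-- The assumptions on the Lagrangian. The second derivative is that of `L` along the segment from
`(q₀, v₀)` to `(q₁, v₁)`. -/
structure IsLagrangian {d : ℕ} (L : E d × E d → ℝ) (c₀ c₁ lam CL : ℝ) : Prop where
  contDiff : ContDiff ℝ 3 L
  c₀_pos : 0 < c₀
  c₁_pos : 0 < c₁
  lam_pos : 0 < lam
  coercive : ∀ q v : E d, c₀ * ‖v‖ ^ 2 ≤ L (q, v)
  gradient_le : ∀ q v : E d, ‖gradient (fun q' : E d => L (q', v)) q‖ ≤ c₁
  le_second_deriv : ∀ q₀ q₁ v₀ v₁ : E d, ∀ ε ∈ Icc (0 : ℝ) 1,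
    lam * ‖v₁ - v₀‖ ^ 2 ≤ iteratedDeriv 2
      (fun e : ℝ => L ((1 - e) • q₀ + e • q₁, (1 - e) • v₀ + e • v₁)) ε
  second_deriv_le : ∀ q₀ q₁ v₀ v₁ : E d, ∀ ε ∈ Icc (0 : ℝ) 1,
    iteratedDeriv 2
      (fun e : ℝ => L ((1 - e) • q₀ + e • q₁, (1 - e) • v₀ + e • v₁)) ε
      ≤ CL * (‖q₁ - q₀‖ ^ 2 + ‖v₁ - v₀‖ ^ 2)

/-- The assumptions on an interaction function, with `c I ≤ ∇²Φ`. -/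
structure IsInteraction {d : ℕ} (Φ : E d → ℝ) (c : ℝ) : Prop where
  contDiff : ContDiff ℝ 3 Φ
  even : ∀ x, Φ (-x) = Φ x
  bddBelow : BddBelow (range Φ)
  bounded_derivs : ∀ k ∈ Icc 1 3, ∃ K : ℝ, ∀ x, ‖iteratedFDeriv ℝ k Φ x‖ ≤ K
  le_hessian : ∀ x y : E d, c * ‖y‖ ^ 2 ≤ iteratedFDeriv ℝ 2 Φ x ![y, y]

/-- `‖∇²Φ‖_{L^∞}`, with the operator norm of the Hessian. -/
def hessianSup {d : ℕ} (Φ : E d → ℝ) : ℝ := ⨆ x, ‖iteratedFDeriv ℝ 2 Φ x‖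

/-- The negative part `c⁻ = max (-c) 0`. -/
def negPt (c : ℝ) : ℝ := max (-c) 0

/-- The constant `C_t = (t/3) (C_L + ‖∇²Φ‖_{L^∞}) + C_L / t`. -/
def upperConst {d : ℕ} (Φ : E d → ℝ) (CL t : ℝ) : ℝ :=
  t / 3 * (CL + hessianSup Φ) + CL / t

end MeanField

end

/-! Everything is expressed through second differences `f (x + h) + f (x - h) - 2 * f x`, which
behave well under infima and integration and spare any second-order calculus on the Hilbert space.
Integrating the pointwise bounds on `L`, `Φ`, `Ψ` gives such bounds for the lifted costs
(`regularRunningCost`, `IsInteraction.regularInitialCost`), and `uhat_eq_value` turns the problem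
into an abstract control problem over square-integrable velocities. Curves are anchored at their
final point, so they are linear in the pair (endpoint, velocity).

Perturbing any competitor for `X` by a fixed curve ending in `±h` bounds the second difference of
the value from above (`value_second_diff_le`). Averaging competitors for `X + h` and `X - h` bounds
it from below (`value_second_diff_ge`): smallness of `T` makes the kinetic convexity `lam` dominate
the concavity of the interactions. Two-sided bounds and local boundedness give differentiability
with quadratic remainder (`exists_clm_of_abs_second_diff_le`) and a Lipschitz gradient
(`norm_gradient_sub_le`). The value is also Lipschitz in time, locally uniformly in `X`;
interpolating with the quadratic remainder makes the gradient Hölder-1/2 in time, hence jointly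
continuous.

The same uniform convexity makes minimizing sequences of velocities Cauchy, so minimizers exist
(`exists_cost_eq_value`). For the endpoint, let `V` be the velocity whose momentum is the gradient
of the value. Comparing an optimal curve on `[s, t]` with the straight line of velocity `V`
(`endpoint_estimate`), uniform convexity controls the squared distance of the velocities, and
continuity of the gradient in time forces the mean velocity on `[s, t]` to tend to `V`. -/

noncomputable section

namespace MeanField

open Filter Topology

/-! ### Calculus from bounds on second differences -/

section SecondDifferences

variable {H : Type*} [NormedAddCommGroup H] [NormedSpace ℝ H]

/-- The difference quotient of `f` at `x` along `2⁻ⁿ h`. -/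
def dyadicQuotient (f : H → ℝ) (x h : H) (n : ℕ) : ℝ :=
  (2 : ℝ) ^ n * (f (x + ((2 : ℝ) ^ n)⁻¹ • h) - f x)

theorem dyadicQuotient_neg (f : H → ℝ) (x h : H) (n : ℕ) :
    dyadicQuotient (fun y => -f y) x h n = -dyadicQuotient f x h n := by
  simp only [dyadicQuotient]; ring

theorem dyadicQuotient_zero (f : H → ℝ) (x h : H) :
    dyadicQuotient f x h 0 = f (x + h) - f x := by
  simp [dyadicQuotient]

/-- This is the second difference centred halfway between `x` and `x + 2⁻ⁿ h`. The bounds are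
geometric and sum to `C / 2 * ‖h‖ ^ 2`, the Taylor remainder. -/
theorem dyadicQuotient_sub_succ_le {f : H → ℝ} {C : ℝ}
    (hC : ∀ x h, f (x + h) + f (x - h) - 2 * f x ≤ C * ‖h‖ ^ 2) (x h : H) (n : ℕ) :
    dyadicQuotient f x h n - dyadicQuotient f x h (n + 1) ≤ C * ‖h‖ ^ 2 / 4 / 2 ^ n := by
  have hp : (0 : ℝ) < 2 ^ n := by positivity
  have key := hC (x + ((2 : ℝ) ^ (n + 1))⁻¹ • h) (((2 : ℝ) ^ (n + 1))⁻¹ • h)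
  have e1 : x + ((2 : ℝ) ^ (n + 1))⁻¹ • h + ((2 : ℝ) ^ (n + 1))⁻¹ • h
      = x + ((2 : ℝ) ^ n)⁻¹ • h := by
    rw [add_assoc, ← add_smul]; congr 2; rw [pow_succ]; field_simp; norm_num
  have e2 : ‖((2 : ℝ) ^ (n + 1))⁻¹ • h‖ ^ 2 = ‖h‖ ^ 2 / 4 / (2 ^ n) ^ 2 := by
    rw [norm_smul, Real.norm_of_nonneg (by positivity)]; field_simp; ring
  rw [e1, add_sub_cancel_right, e2] at key
  have := mul_le_mul_of_nonneg_left key hp.le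
  have e3 : (2 : ℝ) ^ n * (C * (‖h‖ ^ 2 / 4 / (2 ^ n) ^ 2)) = C * ‖h‖ ^ 2 / 4 / 2 ^ n := by
    field_simp
  rw [e3] at this
  simp only [dyadicQuotient, pow_succ] at this ⊢
  linarith

theorem tendsto_dyadicQuotient {f : H → ℝ} {D : H →L[ℝ] ℝ} {x : H} (hf : HasFDerivAt f D x)
    (h : H) : Tendsto (dyadicQuotient f x h) atTop (𝓝 (D h)) := by
  have := hf.lim h (c := fun n : ℕ => (2 : ℝ) ^ n) (l := atTop) (by
    simpa using tendsto_pow_atTop_atTop_of_one_lt (one_lt_two : (1 : ℝ) < 2))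
  exact this

/-- An upper bound on second differences gives a quadratic upper bound by the tangent. -/
theorem le_of_second_diff_le {f : H → ℝ} {C : ℝ}
    (hC : ∀ x h, f (x + h) + f (x - h) - 2 * f x ≤ C * ‖h‖ ^ 2)
    {D : H →L[ℝ] ℝ} {x : H} (hf : HasFDerivAt f D x) (h : H) :
    f (x + h) ≤ f x + D h + C / 2 * ‖h‖ ^ 2 := by
  have step : ∀ n : ℕ, f (x + h) - f x
      ≤ dyadicQuotient f x h n + C / 2 * ‖h‖ ^ 2 * (1 - ((2 : ℝ) ^ n)⁻¹) := by
    intro n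
    induction n with
    | zero => simp [dyadicQuotient_zero]
    | succ n ih =>
      have := dyadicQuotient_sub_succ_le hC x h n
      have e : C / 2 * ‖h‖ ^ 2 * (1 - ((2 : ℝ) ^ (n + 1))⁻¹)
          = C / 2 * ‖h‖ ^ 2 * (1 - ((2 : ℝ) ^ n)⁻¹) + C * ‖h‖ ^ 2 / 4 / 2 ^ n := by
        rw [pow_succ]; field_simp; ring
      rw [e]; linarith
  have hl : Tendsto (fun n : ℕ => dyadicQuotient f x h n
      + C / 2 * ‖h‖ ^ 2 * (1 - ((2 : ℝ) ^ n)⁻¹)) atTop (𝓝 (D h + C / 2 * ‖h‖ ^ 2 * (1 - 0))) := by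
    refine (tendsto_dyadicQuotient hf h).add ((tendsto_const_nhds.sub ?_).const_mul _)
    exact (tendsto_pow_atTop_atTop_of_one_lt (one_lt_two : (1 : ℝ) < 2)).inv_tendsto_atTop
  have := ge_of_tendsto' hl step
  linarith

/-- A lower bound on second differences gives a quadratic lower bound by the tangent. -/
theorem ge_of_le_second_diff {f : H → ℝ} {m : ℝ}
    (hm : ∀ x h, m * ‖h‖ ^ 2 ≤ f (x + h) + f (x - h) - 2 * f x)
    {D : H →L[ℝ] ℝ} {x : H} (hf : HasFDerivAt f D x) (h : H) :
    f x + D h + m / 2 * ‖h‖ ^ 2 ≤ f (x + h) := by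
  have := le_of_second_diff_le (f := fun y => -f y) (C := -m)
    (fun x h => by linarith [hm x h]) hf.neg h
  simp only [neg_apply] at this
  linarith

/-- A locally bounded function with bounded second differences is differentiable, with a
quadratic remainder. -/
theorem exists_clm_of_abs_second_diff_le {f : H → ℝ} {C : ℝ}
    (hC : ∀ x h, |f (x + h) + f (x - h) - 2 * f x| ≤ C * ‖h‖ ^ 2) {x : H}
    (hb : ∃ r > 0, ∃ M, ∀ h, ‖h‖ ≤ r → |f (x + h)| ≤ M) :
    ∃ D : H →L[ℝ] ℝ, ∀ h, |f (x + h) - f x - D h| ≤ C / 2 * ‖h‖ ^ 2 := by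
  -- Consecutive dyadic quotients are geometrically close, so they converge; the limit is the
  -- candidate derivative.
  have hdist : ∀ h n, dist (dyadicQuotient f x h n) (dyadicQuotient f x h (n + 1))
      ≤ C / 2 * ‖h‖ ^ 2 / 2 / 2 ^ n := by
    intro h n
    have h1 := dyadicQuotient_sub_succ_le (fun x h => (abs_le.1 (hC x h)).2) x h n
    have h2 := dyadicQuotient_sub_succ_le (f := fun y => -f y) (C := C)
      (fun x h => by linarith [(abs_le.1 (hC x h)).1]) x h n
    rw [dyadicQuotient_neg, dyadicQuotient_neg] at h2
    have e : C * ‖h‖ ^ 2 / 4 / 2 ^ n = C / 2 * ‖h‖ ^ 2 / 2 / 2 ^ n := by ring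
    rw [e] at h1 h2
    rw [Real.dist_eq, abs_le]
    constructor <;> linarith
  have hlim : ∀ h, ∃ a, Tendsto (dyadicQuotient f x h) atTop (𝓝 a) := fun h =>
    cauchySeq_tendsto_of_complete (cauchySeq_of_le_geometric_two (hdist h))
  choose ℓ hℓ using hlim
  have hbound : ∀ h, |f (x + h) - f x - ℓ h| ≤ C / 2 * ‖h‖ ^ 2 := by
    intro h
    have := dist_le_of_le_geometric_two_of_tendsto₀ (hdist h) (hℓ h)
    rwa [dyadicQuotient_zero, Real.dist_eq] at this
  -- Additivity: the points displaced by `2⁻ⁿ h` and `2⁻ⁿ k` are symmetric about the one displaced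
  -- by `2⁻ⁿ⁻¹ (h + k)`, so the defect is a second difference times `2ⁿ`, of order `2⁻ⁿ`.
  have hadd : ∀ h k, ℓ (h + k) = ℓ h + ℓ k := by
    intro h k
    have h1 : Tendsto (fun n => dyadicQuotient f x (h + k) (n + 1)
        - (dyadicQuotient f x h n + dyadicQuotient f x k n)) atTop
        (𝓝 (ℓ (h + k) - (ℓ h + ℓ k))) :=
      ((hℓ (h + k)).comp (tendsto_add_atTop_nat 1)).sub ((hℓ h).add (hℓ k))
    have h2 : Tendsto (fun n => dyadicQuotient f x (h + k) (n + 1)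
        - (dyadicQuotient f x h n + dyadicQuotient f x k n)) atTop (𝓝 0) := by
      have h3 : Tendsto (fun n : ℕ => C * ‖h - k‖ ^ 2 / 4 * ((2 : ℝ) ^ n)⁻¹) atTop (𝓝 0) := by
        simpa using ((tendsto_pow_atTop_atTop_of_one_lt
          (one_lt_two : (1 : ℝ) < 2)).inv_tendsto_atTop).const_mul (C * ‖h - k‖ ^ 2 / 4)
      refine squeeze_zero_norm (fun n => ?_) h3
      have hp : (0 : ℝ) < 2 ^ n := by positivity
      have key := hC (x + ((2 : ℝ) ^ (n + 1))⁻¹ • (h + k)) (((2 : ℝ) ^ (n + 1))⁻¹ • (h - k))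
      have hs : ((2 : ℝ) ^ (n + 1))⁻¹ + ((2 : ℝ) ^ (n + 1))⁻¹ = ((2 : ℝ) ^ n)⁻¹ := by
        rw [pow_succ]; field_simp; norm_num
      have e1 : x + ((2 : ℝ) ^ (n + 1))⁻¹ • (h + k) + ((2 : ℝ) ^ (n + 1))⁻¹ • (h - k)
          = x + ((2 : ℝ) ^ n)⁻¹ • h := by
        rw [← hs]; module
      have e1' : x + ((2 : ℝ) ^ (n + 1))⁻¹ • (h + k) - ((2 : ℝ) ^ (n + 1))⁻¹ • (h - k)
          = x + ((2 : ℝ) ^ n)⁻¹ • k := by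
        rw [← hs]; module
      have e2 : ‖((2 : ℝ) ^ (n + 1))⁻¹ • (h - k)‖ ^ 2 = ‖h - k‖ ^ 2 / 4 / (2 ^ n) ^ 2 := by
        rw [norm_smul, Real.norm_of_nonneg (by positivity)]; field_simp; ring
      rw [e1, e1', e2] at key
      have e4 : dyadicQuotient f x (h + k) (n + 1)
          - (dyadicQuotient f x h n + dyadicQuotient f x k n)
          = -((2 : ℝ) ^ n * (f (x + ((2 : ℝ) ^ n)⁻¹ • h) + f (x + ((2 : ℝ) ^ n)⁻¹ • k)
            - 2 * f (x + ((2 : ℝ) ^ (n + 1))⁻¹ • (h + k)))) := by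
        simp only [dyadicQuotient, pow_succ]; ring
      rw [e4, norm_neg, Real.norm_eq_abs, abs_mul, abs_of_pos hp]
      refine (mul_le_mul_of_nonneg_left key hp.le).trans_eq ?_
      field_simp
    have := tendsto_nhds_unique h1 h2
    linarith
  -- An additive map bounded near zero is continuous, hence real-linear.
  let A : H →+ ℝ := AddMonoidHom.mk' ℓ hadd
  obtain ⟨r, hr, M, hM⟩ := hb
  have hA : Continuous A := by
    refine A.continuous_of_isBounded_nhds_zero (Metric.closedBall_mem_nhds 0 hr) ?_
    refine (Metric.isBounded_iff_subset_closedBall 0).2 ⟨2 * M + |C| / 2 * r ^ 2, ?_⟩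
    rintro _ ⟨h, hh, rfl⟩
    have hh' : ‖h‖ ≤ r := by simpa using hh
    have h0 := abs_le.1 (hM 0 (by simpa using hr.le))
    have h1 := abs_le.1 (hM h hh')
    have h2 := abs_le.1 (hbound h)
    have h3 : C / 2 * ‖h‖ ^ 2 ≤ |C| / 2 * r ^ 2 := by
      gcongr; exact le_abs_self C
    rw [add_zero] at h0
    rw [Metric.mem_closedBall, dist_zero_right, Real.norm_eq_abs, abs_le]
    change _ ≤ ℓ h ∧ ℓ h ≤ _
    constructor <;> linarith
  exact ⟨A.toRealLinearMap hA, hbound⟩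

theorem hasFDerivAt_of_abs_le_sq {f : H → ℝ} {x : H} {D : H →L[ℝ] ℝ} {C : ℝ}
    (h : ∀ h, |f (x + h) - f x - D h| ≤ C * ‖h‖ ^ 2) : HasFDerivAt f D x := by
  rw [hasFDerivAt_iff_isLittleO_nhds_zero]
  have h1 : (fun h => f (x + h) - f x - D h) =O[𝓝 0] fun h : H => ‖h‖ ^ 2 :=
    Asymptotics.IsBigO.of_bound C (Eventually.of_forall fun k => by
      simpa using h k)
  exact h1.trans_isLittleO (Asymptotics.isLittleO_norm_pow_id one_lt_two)

theorem differentiable_of_abs_second_diff_le {f : H → ℝ} {C : ℝ}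
    (hC : ∀ x h, |f (x + h) + f (x - h) - 2 * f x| ≤ C * ‖h‖ ^ 2)
    (hb : ∀ x, ∃ r > 0, ∃ M, ∀ h, ‖h‖ ≤ r → |f (x + h)| ≤ M) : Differentiable ℝ f := by
  intro x
  obtain ⟨D, hD⟩ := exists_clm_of_abs_second_diff_le hC (hb x)
  exact (hasFDerivAt_of_abs_le_sq hD).differentiableAt

/-- A continuous, uniformly midpoint-convex function that is bounded below on a complete space
has a minimizer. -/
theorem exists_forall_le_of_le_second_diff [CompleteSpace H] {f : H → ℝ} (hf : Continuous f)
    {α : ℝ} (hα : 0 < α) (hb : BddBelow (range f))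
    (hm : ∀ x h, α * ‖h‖ ^ 2 ≤ f (x + h) + f (x - h) - 2 * f x) : ∃ x, ∀ y, f x ≤ f y := by
  set I := sInf (range f) with hI
  have hle : ∀ y, I ≤ f y := fun y => csInf_le hb (mem_range_self y)
  have hex : ∀ n : ℕ, ∃ x, f x < I + 1 / ((n : ℝ) + 1) := by
    intro n
    obtain ⟨_, ⟨x, rfl⟩, hx⟩ := exists_lt_of_csInf_lt (range_nonempty f)
      (show sInf (range f) < I + 1 / ((n : ℝ) + 1) by
        have : (0 : ℝ) < 1 / ((n : ℝ) + 1) := by positivity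
        linarith)
    exact ⟨x, hx⟩
  choose x hx using hex
  -- Almost-minimality of `x n` and `x m`, tested at their midpoint, makes the sequence Cauchy; no
  -- compactness is involved.
  have hclose : ∀ n m N : ℕ, N ≤ n → N ≤ m →
      ‖x n - x m‖ ^ 2 ≤ 8 / α * (1 / ((N : ℝ) + 1)) := by
    intro n m N hn hm'
    have h1 := hm ((1 / 2 : ℝ) • (x n + x m)) ((1 / 2 : ℝ) • (x n - x m))
    have e1 : (1 / 2 : ℝ) • (x n + x m) + (1 / 2 : ℝ) • (x n - x m) = x n := by module
    have e2 : (1 / 2 : ℝ) • (x n + x m) - (1 / 2 : ℝ) • (x n - x m) = x m := by module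
    rw [e1, e2, norm_smul, mul_pow] at h1
    have h2 := hle ((1 / 2 : ℝ) • (x n + x m))
    have h3 : 1 / ((n : ℝ) + 1) ≤ 1 / ((N : ℝ) + 1) := by gcongr
    have h4 : 1 / ((m : ℝ) + 1) ≤ 1 / ((N : ℝ) + 1) := by gcongr
    have h5 := hx n
    have h6 := hx m
    have e3 : ‖(1 / 2 : ℝ)‖ ^ 2 = 1 / 4 := by norm_num
    rw [e3] at h1
    rw [div_mul_eq_mul_div, le_div_iff₀ hα]
    linarith
  have hlim0 : Tendsto (fun N : ℕ => √(8 / α * (1 / ((N : ℝ) + 1)))) atTop (𝓝 0) := by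
    have := (tendsto_one_div_add_atTop_nhds_zero_nat (𝕜 := ℝ)).const_mul (8 / α)
    have := (Real.continuous_sqrt.tendsto _).comp this
    simpa [Function.comp_def] using this
  have hcauchy : CauchySeq x := by
    refine cauchySeq_of_le_tendsto_0 _ (fun n m N hn hm' => ?_) hlim0
    rw [dist_eq_norm]
    exact Real.le_sqrt_of_sq_le (hclose n m N hn hm')
  obtain ⟨a, ha⟩ := cauchySeq_tendsto_of_complete hcauchy
  refine ⟨a, fun y => le_trans ?_ (hle y)⟩
  have h1 : Tendsto (fun n => f (x n)) atTop (𝓝 (f a)) := (hf.tendsto a).comp ha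
  have h2 : Tendsto (fun n : ℕ => I + 1 / ((n : ℝ) + 1)) atTop (𝓝 (I + 0)) :=
    tendsto_const_nhds.add tendsto_one_div_add_atTop_nhds_zero_nat
  have := le_of_tendsto_of_tendsto' h1 h2 (fun n => (hx n).le)
  simpa using this

end SecondDifferences

/-! ### Lipschitz gradients in Hilbert space -/

section Gradient

variable {H : Type*} [NormedAddCommGroup H] [InnerProductSpace ℝ H] [CompleteSpace H]

theorem abs_sub_inner_gradient_le {f : H → ℝ} {C : ℝ}
    (hC : ∀ x h, |f (x + h) + f (x - h) - 2 * f x| ≤ C * ‖h‖ ^ 2) (hf : Differentiable ℝ f)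
    (x h : H) : |f (x + h) - f x - inner ℝ (gradient f x) h| ≤ C / 2 * ‖h‖ ^ 2 := by
  have hd := (hf x).hasFDerivAt
  have e : inner ℝ (gradient f x) h = fderiv ℝ f x h := by
    simp [gradient]
  have h1 := le_of_second_diff_le (fun x h => (abs_le.1 (hC x h)).2) hd h
  have h2 := ge_of_le_second_diff (m := -C)
    (fun x h => by linarith [(abs_le.1 (hC x h)).1]) hd h
  rw [e, abs_le]
  constructor <;> linarith

/-- The gradient of a function whose second differences are bounded by `C ‖h‖²` is
`C`-Lipschitz. -/
theorem norm_gradient_sub_le {f : H → ℝ} {C : ℝ}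
    (hC : ∀ x h, |f (x + h) + f (x - h) - 2 * f x| ≤ C * ‖h‖ ^ 2) (hf : Differentiable ℝ f)
    (x y : H) : ‖gradient f x - gradient f y‖ ≤ C * ‖x - y‖ := by
  set w := gradient f x - gradient f y with hw
  rcases eq_or_ne w 0 with h0 | h0
  · rw [h0, norm_zero]
    rcases eq_or_ne x y with rfl | hxy
    · simp
    have h1 := (abs_nonneg _).trans (hC x (x - y))
    have h2 : 0 < ‖x - y‖ := norm_pos_iff.2 (sub_ne_zero.2 hxy)
    have h3 : 0 ≤ (C * ‖x - y‖) * ‖x - y‖ := by nlinarith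
    exact nonneg_of_mul_nonneg_left h3 h2
  have hw0 : 0 < ‖w‖ := norm_pos_iff.2 h0
  have hxy : x ≠ y := by rintro rfl; simp [hw] at h0
  have hu0 : 0 < ‖x - y‖ := norm_pos_iff.2 (sub_ne_zero.2 hxy)
  -- The tangent inequalities at `x` and `y` are compared at midpoint `± h`. With `‖h‖ = ‖u‖` and
  -- `h` opposite to `w`, the parallelogram law yields the constant `C` without loss.
  set u := (1 / 2 : ℝ) • (y - x) with hu
  have hun : ‖u‖ = ‖x - y‖ / 2 := by
    rw [hu, norm_smul, norm_sub_rev]; norm_num; ring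
  set h := -(‖u‖ / ‖w‖) • w with hh
  have hhn : ‖h‖ = ‖u‖ := by
    rw [hh, norm_smul, norm_neg, Real.norm_of_nonneg (by positivity)]
    field_simp
  have hin : inner ℝ w h = -(‖u‖ * ‖w‖) := by
    rw [hh, inner_smul_right, real_inner_self_eq_norm_sq]; field_simp
  have key := abs_sub_inner_gradient_le hC hf
  have k1 := (abs_le.1 (key x (u + h))).2
  have k2 := (abs_le.1 (key y (-u + h))).1
  have k3 := (abs_le.1 (key x (u - h))).1
  have k4 := (abs_le.1 (key y (-u - h))).2
  have e1 : x + (u + h) = y + (-u + h) := by rw [hu]; module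
  have e2 : x + (u - h) = y + (-u - h) := by rw [hu]; module
  rw [e1] at k1
  rw [e2] at k3
  have p1 := parallelogram_law_with_norm ℝ u h
  have p2 := parallelogram_law_with_norm ℝ (-u) h
  rw [norm_neg] at p2
  simp only [inner_add_right, inner_sub_right, inner_neg_right] at k1 k2 k3 k4
  have hin' : inner ℝ (gradient f x) h - inner ℝ (gradient f y) h = -(‖u‖ * ‖w‖) := by
    rw [← hin, hw, inner_sub_left]
  have q1 : C * (‖u + h‖ ^ 2 + ‖u - h‖ ^ 2) = C * (4 * ‖u‖ ^ 2) := by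
    rw [hhn] at p1; rw [show ‖u + h‖ ^ 2 + ‖u - h‖ ^ 2 = 4 * ‖u‖ ^ 2 by linarith]
  have q2 : C * (‖-u + h‖ ^ 2 + ‖-u - h‖ ^ 2) = C * (4 * ‖u‖ ^ 2) := by
    rw [hhn] at p2; rw [show ‖-u + h‖ ^ 2 + ‖-u - h‖ ^ 2 = 4 * ‖u‖ ^ 2 by linarith]
  have hfin : ‖u‖ * ‖w‖ ≤ C * (2 * ‖u‖ ^ 2) := by linarith
  rw [hun] at hfin
  have : ‖x - y‖ * ‖w‖ ≤ ‖x - y‖ * (C * ‖x - y‖) := by linarith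
  exact le_of_mul_le_mul_left this hu0

end Gradient

/-! ### The abstract control problem and second differences of its cost -/

section Control

set_option linter.unusedSectionVars false

/-- Cauchy–Schwarz against the constant function. -/
theorem integral_norm_sq_le {α F : Type*} [MeasurableSpace α] [NormedAddCommGroup F]
    {μ : Measure α} [IsFiniteMeasure μ] {f : α → F} (hf : MemLp f 2 μ) :
    (∫ a, ‖f a‖ ∂μ) ^ 2 ≤ μ.real univ * ∫ a, ‖f a‖ ^ 2 ∂μ := by
  have i1 : Integrable (fun a => ‖f a‖) μ := (hf.integrable one_le_two).norm
  have i2 : Integrable (fun a => ‖f a‖ ^ 2) μ := hf.integrable_norm_pow (by norm_num)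
  set N := ∫ a, ‖f a‖ ∂μ with hN
  set m := μ.real univ with hm
  rcases eq_or_lt_of_le (measureReal_nonneg : 0 ≤ μ.real univ) with h0 | h0
  · have : μ = 0 := by
      have h1 : μ univ = 0 := by
        rw [← measureReal_eq_zero_iff]; exact h0.symm
      exact Measure.measure_univ_eq_zero.1 h1
    simp [hN, this]
  -- Expanding this square gives Cauchy–Schwarz, after division by the mass `m > 0`.
  have h1 : 0 ≤ ∫ a, (m * ‖f a‖ - N) ^ 2 ∂μ := integral_nonneg fun a => sq_nonneg _
  have h2 : ∫ a, (m * ‖f a‖ - N) ^ 2 ∂μ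
      = m ^ 2 * (∫ a, ‖f a‖ ^ 2 ∂μ) - 2 * m * N * N + N ^ 2 * m := by
    have e : ∀ a, (m * ‖f a‖ - N) ^ 2 = m ^ 2 * ‖f a‖ ^ 2 - 2 * m * N * ‖f a‖ + N ^ 2 :=
      fun a => by ring
    simp_rw [e]
    rw [integral_add (f := fun a => m ^ 2 * ‖f a‖ ^ 2 - 2 * m * N * ‖f a‖)
      ((i2.const_mul _).sub (i1.const_mul _)) (integrable_const _), integral_sub (i2.const_mul _) (i1.const_mul _), integral_const_mul, integral_const_mul,
      integral_const, smul_eq_mul]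
    ring
  rw [h2] at h1
  have h3 : 0 ≤ m * (m * (∫ a, ‖f a‖ ^ 2 ∂μ) - N ^ 2) := by linarith
  have := nonneg_of_mul_nonneg_right h3 h0
  linarith

variable {H : Type*} [NormedAddCommGroup H] [InnerProductSpace ℝ H]

/-- A running cost on a Hilbert space, with bounds on its second differences. -/
structure RegularRunningCost (ℓ : H → H → ℝ) (lam CL K c : ℝ) : Prop where
  lam_pos : 0 < lam
  K_nonneg : 0 ≤ K
  c_nonneg : 0 ≤ c
  lower : ∀ x v a b, lam * ‖b‖ ^ 2 - c * ‖a‖ ^ 2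
    ≤ ℓ (x + a) (v + b) + ℓ (x - a) (v - b) - 2 * ℓ x v
  upper : ∀ x v a b, ℓ (x + a) (v + b) + ℓ (x - a) (v - b) - 2 * ℓ x v
    ≤ CL * (‖a‖ ^ 2 + ‖b‖ ^ 2) + K * ‖a‖ ^ 2
  lipschitz : ∃ Λ, 0 ≤ Λ ∧ ∀ x y v, |ℓ x v - ℓ y v| ≤ Λ * ‖x - y‖
  coercive : ∃ c₀ B, 0 < c₀ ∧ 0 ≤ B ∧ ∀ x v, c₀ * ‖v‖ ^ 2 - B ≤ ℓ x v
  growth : ∃ A, 0 ≤ A ∧ ∀ x v, ℓ x v ≤ A * (1 + ‖x‖ + ‖v‖ ^ 2)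

/-- An initial cost on a Hilbert space, with bounds on its second differences. -/
structure RegularInitialCost (u : H → ℝ) (K c : ℝ) : Prop where
  K_nonneg : 0 ≤ K
  c_nonneg : 0 ≤ c
  lower : ∀ x a, -c * ‖a‖ ^ 2 ≤ u (x + a) + u (x - a) - 2 * u x
  upper : ∀ x a, u (x + a) + u (x - a) - 2 * u x ≤ K * ‖a‖ ^ 2
  lipschitz : ∃ Λ, 0 ≤ Λ ∧ ∀ x y, |u x - u y| ≤ Λ * ‖x - y‖
  bddBelow : ∃ B, ∀ x, B ≤ u x

/-- Square-integrable velocities on `(0,t]`. -/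
def Admissible (t : ℝ) (v : ℝ → H) : Prop := MemLp v 2 (volume.restrict (Ioc 0 t))

/-- The curve with velocity `v` that ends in `X` at time `t`. -/
def curve (t : ℝ) (X : H) (v : ℝ → H) (s : ℝ) : H := X - ∫ r in s..t, v r

/-- The kinetic energy `∫₀ᵗ ‖v‖²`. -/
def energy (t : ℝ) (v : ℝ → H) : ℝ := ∫ s in (0 : ℝ)..t, ‖v s‖ ^ 2

/-- The cost of the curve with velocity `v` that ends in `X`. -/
def cost (ℓ : H → H → ℝ) (u : H → ℝ) (t : ℝ) (X : H) (v : ℝ → H) : ℝ :=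
  (∫ s in (0 : ℝ)..t, ℓ (curve t X v s) (v s)) + u (curve t X v 0)

/-- The value function of the control problem with running cost `ℓ` and initial cost `u`. -/
def value (ℓ : H → H → ℝ) (u : H → ℝ) (t : ℝ) (X : H) : ℝ :=
  sInf {a : ℝ | ∃ v, Admissible t v ∧ a = cost ℓ u t X v}

variable {ℓ : H → H → ℝ} {u : H → ℝ} {lam CL K c Ku cu t s : ℝ} {X Y h : H} {v w : ℝ → H}

theorem admissible_const (t : ℝ) (x : H) : Admissible t (fun _ => x) := memLp_const x

theorem Admissible.add (hv : Admissible t v) (hw : Admissible t w) :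
    Admissible t (fun s => v s + w s) := MemLp.add hv hw

theorem Admissible.sub (hv : Admissible t v) (hw : Admissible t w) :
    Admissible t (fun s => v s - w s) := MemLp.sub hv hw

theorem Admissible.const_smul (hv : Admissible t v) (a : ℝ) :
    Admissible t (fun s => a • v s) := MemLp.const_smul hv a

theorem Admissible.mono (hv : Admissible t v) (hs : s ≤ t) : Admissible s v :=
  MemLp.mono_measure (Measure.restrict_mono (Ioc_subset_Ioc_right hs) le_rfl) hv

theorem Admissible.memLp_Ioc (hv : Admissible t v) (hs : 0 ≤ s) :
    MemLp v 2 (volume.restrict (Ioc s t)) :=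
  MemLp.mono_measure (Measure.restrict_mono (Ioc_subset_Ioc_left hs) le_rfl) hv

theorem Admissible.intervalIntegrable (hv : Admissible t v) (ht : 0 ≤ t) :
    IntervalIntegrable v volume 0 t := by
  rw [intervalIntegrable_iff_integrableOn_Ioc_of_le ht]
  exact MemLp.integrable one_le_two hv

theorem Admissible.intervalIntegrable_right (hv : Admissible t v) (hs : s ∈ Icc 0 t) :
    IntervalIntegrable v volume s t :=
  (hv.intervalIntegrable (hs.1.trans hs.2)).mono_set (by
    rw [uIcc_of_le hs.2, uIcc_of_le (hs.1.trans hs.2)]; exact Icc_subset_Icc_left hs.1)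

theorem Admissible.intervalIntegrable_norm_sq (hv : Admissible t v) (ht : 0 ≤ t) :
    IntervalIntegrable (fun s => ‖v s‖ ^ 2) volume 0 t := by
  rw [intervalIntegrable_iff_integrableOn_Ioc_of_le ht]
  exact MemLp.integrable_norm_pow hv (by norm_num)

theorem Admissible.intervalIntegrable_norm_sq_right (hv : Admissible t v) (hs : s ∈ Icc 0 t) :
    IntervalIntegrable (fun s => ‖v s‖ ^ 2) volume s t :=
  (hv.intervalIntegrable_norm_sq (hs.1.trans hs.2)).mono_set (by
    rw [uIcc_of_le hs.2, uIcc_of_le (hs.1.trans hs.2)]; exact Icc_subset_Icc_left hs.1)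

theorem energy_nonneg (ht : 0 ≤ t) : 0 ≤ energy t v :=
  intervalIntegral.integral_nonneg ht fun _ _ => by positivity

theorem Admissible.norm_integral_sq_le (hv : Admissible t v) (hs : s ∈ Icc 0 t) :
    ‖∫ r in s..t, v r‖ ^ 2 ≤ (t - s) * ∫ r in s..t, ‖v r‖ ^ 2 := by
  have h1 := integral_norm_sq_le (hv.memLp_Ioc hs.1)
  rw [measureReal_restrict_apply_univ, Real.volume_real_Ioc_of_le hs.2,
    ← intervalIntegral.integral_of_le hs.2, ← intervalIntegral.integral_of_le hs.2] at h1
  refine le_trans ?_ h1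
  gcongr
  exact intervalIntegral.norm_integral_le_integral_norm hs.2

theorem Admissible.integral_norm_sq_le_energy (hv : Admissible t v) (hs : s ∈ Icc 0 t) :
    ∫ r in s..t, ‖v r‖ ^ 2 ≤ energy t v := by
  have ht := hs.1.trans hs.2
  refine intervalIntegral.integral_mono_interval hs.1 hs.2 le_rfl ?_
    (hv.intervalIntegrable_norm_sq ht)
  exact Eventually.of_forall fun _ => by positivity

/-- The two factors `2` here are the origin of those in the convexity constant `lam - 2 * t ^ 2 * c
- 2 * t * cu` and in the semiconvexity bound. -/
theorem Admissible.norm_curve_sq_le (hv : Admissible t v) (hs : s ∈ Icc 0 t) (X : H) :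
    ‖curve t X v s‖ ^ 2 ≤ 2 * ‖X‖ ^ 2 + 2 * (t * energy t v) := by
  have h1 := hv.norm_integral_sq_le hs
  have h2 := hv.integral_norm_sq_le_energy hs
  have h3 : (t - s) * ∫ r in s..t, ‖v r‖ ^ 2 ≤ t * energy t v := by
    have := energy_nonneg (v := v) (hs.1.trans hs.2)
    have h5 : 0 ≤ t - s := by linarith [hs.2]
    have h6 : t - s ≤ t := by linarith [hs.1]
    exact mul_le_mul h6 h2 (intervalIntegral.integral_nonneg hs.2 fun _ _ => by positivity)
      (hs.1.trans hs.2)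
  have h4 := norm_sub_le X (∫ r in s..t, v r)
  have h7 := pow_le_pow_left₀ (norm_nonneg _) h4 2
  unfold curve
  nlinarith [sq_nonneg (‖X‖ - ‖∫ r in s..t, v r‖)]

@[simp] theorem curve_self (t : ℝ) (X : H) (v : ℝ → H) : curve t X v t = X := by simp [curve]

theorem curve_add (hv : Admissible t v) (hw : Admissible t w) (hs : s ∈ Icc 0 t) (X h : H) :
    curve t (X + h) (fun r => v r + w r) s = curve t X v s + curve t h w s := by
  unfold curve
  rw [intervalIntegral.integral_add (hv.intervalIntegrable_right hs)
    (hw.intervalIntegrable_right hs)]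
  abel

theorem curve_sub (hv : Admissible t v) (hw : Admissible t w) (hs : s ∈ Icc 0 t) (X h : H) :
    curve t (X - h) (fun r => v r - w r) s = curve t X v s - curve t h w s := by
  unfold curve
  rw [intervalIntegral.integral_sub (hv.intervalIntegrable_right hs)
    (hw.intervalIntegrable_right hs)]
  abel

theorem curve_sub_curve (t : ℝ) (X Y : H) (v : ℝ → H) (s : ℝ) :
    curve t X v s - curve t Y v s = X - Y := by
  unfold curve; abel

theorem continuousOn_curve (hv : Admissible t v) (ht : 0 ≤ t) (X : H) :
    ContinuousOn (curve t X v) (Icc 0 t) := by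
  unfold curve
  have := intervalIntegral.continuousOn_primitive_interval_left
    (μ := volume) (f := v) (a := 0) (b := t) (by
      rw [uIcc_of_le ht, integrableOn_Icc_iff_integrableOn_Ioc]
      exact MemLp.integrable one_le_two hv)
  rw [uIcc_of_le ht] at this
  exact continuousOn_const.sub this

theorem curve_congr {v' : ℝ → H} (h : v =ᵐ[volume.restrict (Ioc 0 t)] v') (hs : s ∈ Icc 0 t) :
    curve t X v s = curve t X v' s := by
  unfold curve
  congr 1
  rw [intervalIntegral.integral_of_le hs.2, intervalIntegral.integral_of_le hs.2]
  exact integral_congr_ae (ae_mono (Measure.restrict_mono (Ioc_subset_Ioc_left hs.1) le_rfl) h)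

/-- Lets the cost descend to `L²` classes of velocities. -/
theorem cost_congr {v' : ℝ → H} (ht : 0 ≤ t) (h : v =ᵐ[volume.restrict (Ioc 0 t)] v') :
    cost ℓ u t X v = cost ℓ u t X v' := by
  unfold cost
  rw [curve_congr h ⟨le_rfl, ht⟩, intervalIntegral.integral_of_le ht,
    intervalIntegral.integral_of_le ht]
  congr 1
  refine integral_congr_ae ?_
  filter_upwards [h, ae_restrict_mem measurableSet_Ioc] with s hs hmem
  rw [hs, curve_congr h ⟨hmem.1.le, hmem.2⟩]

theorem RegularRunningCost.abs_second_diff_le (hℓ : RegularRunningCost ℓ lam CL K c) (x v b : H) :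
    |ℓ x (v + b) + ℓ x (v - b) - 2 * ℓ x v| ≤ CL * ‖b‖ ^ 2 := by
  have h1 := hℓ.lower x v 0 b
  have h2 := hℓ.upper x v 0 b
  simp only [add_zero, sub_zero, norm_zero] at h1 h2
  have := hℓ.lam_pos
  have : 0 ≤ lam * ‖b‖ ^ 2 := by positivity
  rw [abs_le]; constructor <;> linarith

/-- For fixed position the cost is differentiable in the velocity by the second-difference
criterion; the Lipschitz bound in position is uniform in the velocity, which gives joint continuity.
-/
theorem RegularRunningCost.continuous (hℓ : RegularRunningCost ℓ lam CL K c) :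
    Continuous fun p : H × H => ℓ p.1 p.2 := by
  obtain ⟨Λ, hΛ0, hΛ⟩ := hℓ.lipschitz
  obtain ⟨c₀, B, hc₀, hB0, hB⟩ := hℓ.coercive
  obtain ⟨A, hA0, hA⟩ := hℓ.growth
  have hd : ∀ x, Differentiable ℝ (ℓ x) := fun x => by
    refine differentiable_of_abs_second_diff_le (hℓ.abs_second_diff_le x) fun v => ?_
    refine ⟨1, one_pos, A * (1 + ‖x‖ + (‖v‖ + 1) ^ 2) + B, fun b hb => abs_le.2 ⟨?_, ?_⟩⟩
    · have := hB x (v + b)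
      have h1 : 0 ≤ c₀ * ‖v + b‖ ^ 2 := by positivity
      have h2 : 0 ≤ A * (1 + ‖x‖ + (‖v‖ + 1) ^ 2) := by positivity
      linarith
    · refine (hA x (v + b)).trans ?_
      have : ‖v + b‖ ≤ ‖v‖ + 1 := (norm_add_le _ _).trans (by linarith)
      have : A * (1 + ‖x‖ + ‖v + b‖ ^ 2) ≤ A * (1 + ‖x‖ + (‖v‖ + 1) ^ 2) := by gcongr
      linarith
  rw [continuous_iff_continuousAt]
  rintro ⟨x, v⟩
  have h1 : Tendsto (fun p : H × H => ℓ x p.2) (𝓝 (x, v)) (𝓝 (ℓ x v)) :=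
    ((hd x).continuous.tendsto v).comp (continuous_snd.tendsto (x, v))
  have h2 : Tendsto (fun p : H × H => ℓ p.1 p.2 - ℓ x p.2) (𝓝 (x, v)) (𝓝 0) := by
    have h3 : Tendsto (fun p : H × H => Λ * ‖p.1 - x‖) (𝓝 (x, v)) (𝓝 0) := by
      have : Continuous fun p : H × H => Λ * ‖p.1 - x‖ := by fun_prop
      simpa using this.tendsto (x, v)
    exact squeeze_zero_norm (fun p => by simpa using hΛ p.1 x p.2) h3
  have := h2.add h1
  simpa [ContinuousAt] using this

theorem RegularRunningCost.intervalIntegrable (hℓ : RegularRunningCost ℓ lam CL K c)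
    (ht : 0 ≤ t) (hv : Admissible t v) {γ : ℝ → H} (hγ : ContinuousOn γ (Icc 0 t)) :
    IntervalIntegrable (fun s => ℓ (γ s) (v s)) volume 0 t := by
  obtain ⟨c₀, B, hc₀, hB0, hB⟩ := hℓ.coercive
  obtain ⟨A, hA0, hA⟩ := hℓ.growth
  obtain ⟨M, hM⟩ := isCompact_Icc.exists_bound_of_continuousOn hγ
  rw [intervalIntegrable_iff_integrableOn_Ioc_of_le ht]
  have i2 : Integrable (fun s => ‖v s‖ ^ 2) (volume.restrict (Ioc 0 t)) :=
    MemLp.integrable_norm_pow hv (by norm_num)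
  refine Integrable.mono' (g := fun s => (A * (1 + M) + B) + A * ‖v s‖ ^ 2)
    ((integrable_const _).add (i2.const_mul A)) ?_ ?_
  · have h1 : AEStronglyMeasurable γ (volume.restrict (Ioc 0 t)) :=
      (hγ.mono Ioc_subset_Icc_self).aestronglyMeasurable measurableSet_Ioc
    exact hℓ.continuous.comp_aestronglyMeasurable (h1.prodMk hv.1)
  · filter_upwards [ae_restrict_mem measurableSet_Ioc] with s hs
    have h1 := hM s (Ioc_subset_Icc_self hs)
    have h2 := hA (γ s) (v s)
    have h3 := hB (γ s) (v s)
    have h4 : A * (1 + ‖γ s‖ + ‖v s‖ ^ 2) ≤ A * (1 + M + ‖v s‖ ^ 2) := by gcongr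
    have h5 : 0 ≤ c₀ * ‖v s‖ ^ 2 := by positivity
    have h6 : 0 ≤ A * (1 + M) := by
      have := (norm_nonneg _).trans h1
      positivity
    have h7 : 0 ≤ A * ‖v s‖ ^ 2 := by positivity
    rw [Real.norm_eq_abs, abs_le]
    constructor <;> linarith

theorem RegularRunningCost.intervalIntegrable_curve (hℓ : RegularRunningCost ℓ lam CL K c)
    (ht : 0 ≤ t) (hv : Admissible t v) (X : H) :
    IntervalIntegrable (fun s => ℓ (curve t X v s) (v s)) volume 0 t :=
  hℓ.intervalIntegrable ht hv (continuousOn_curve hv ht X)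

theorem cost_second_diff_eq (hℓ : RegularRunningCost ℓ lam CL K c) (ht : 0 ≤ t)
    (hv : Admissible t v) (hw : Admissible t w) (X h : H) :
    cost ℓ u t (X + h) (fun s => v s + w s) + cost ℓ u t (X - h) (fun s => v s - w s)
      - 2 * cost ℓ u t X v
    = (∫ s in (0 : ℝ)..t, (ℓ (curve t X v s + curve t h w s) (v s + w s)
        + ℓ (curve t X v s - curve t h w s) (v s - w s) - 2 * ℓ (curve t X v s) (v s)))
      + (u (curve t X v 0 + curve t h w 0) + u (curve t X v 0 - curve t h w 0)
        - 2 * u (curve t X v 0)) ∧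
    IntervalIntegrable (fun s => ℓ (curve t X v s + curve t h w s) (v s + w s)
        + ℓ (curve t X v s - curve t h w s) (v s - w s) - 2 * ℓ (curve t X v s) (v s))
        volume 0 t := by
  have hcv := continuousOn_curve hv ht X
  have hcw := continuousOn_curve hw ht h
  have i1 : IntervalIntegrable (fun s => ℓ (curve t X v s + curve t h w s) (v s + w s))
    volume 0 t := hℓ.intervalIntegrable ht (hv.add hw) (hcv.add hcw)
  have i2 : IntervalIntegrable (fun s => ℓ (curve t X v s - curve t h w s) (v s - w s))
    volume 0 t := hℓ.intervalIntegrable ht (hv.sub hw) (hcv.sub hcw)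
  have i3 := hℓ.intervalIntegrable ht hv hcv
  refine ⟨?_, (i1.add i2).sub (i3.const_mul 2)⟩
  rw [intervalIntegral.integral_sub (i1.add i2) (i3.const_mul 2),
    intervalIntegral.integral_add i1 i2, intervalIntegral.integral_const_mul]
  unfold cost
  have e0 : (0 : ℝ) ∈ Icc 0 t := ⟨le_rfl, ht⟩
  rw [curve_add hv hw e0, curve_sub hv hw e0]
  have e1 : ∫ s in (0 : ℝ)..t, ℓ (curve t (X + h) (fun s => v s + w s) s) (v s + w s)
      = ∫ s in (0 : ℝ)..t, ℓ (curve t X v s + curve t h w s) (v s + w s) :=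
    intervalIntegral.integral_congr fun s hs => by
      rw [uIcc_of_le ht] at hs
      simp only [curve_add hv hw hs]
  have e2 : ∫ s in (0 : ℝ)..t, ℓ (curve t (X - h) (fun s => v s - w s) s) (v s - w s)
      = ∫ s in (0 : ℝ)..t, ℓ (curve t X v s - curve t h w s) (v s - w s) :=
    intervalIntegral.integral_congr fun s hs => by
      rw [uIcc_of_le ht] at hs
      simp only [curve_sub hv hw hs]
  rw [e1, e2]
  ring

theorem cost_second_diff_ge (hℓ : RegularRunningCost ℓ lam CL K c)
    (hu : RegularInitialCost u Ku cu) (ht : 0 ≤ t)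
    (hv : Admissible t v) (hw : Admissible t w) (X h : H) :
    (lam - 2 * t ^ 2 * c - 2 * t * cu) * energy t w - 2 * (t * c + cu) * ‖h‖ ^ 2
    ≤ cost ℓ u t (X + h) (fun s => v s + w s) + cost ℓ u t (X - h) (fun s => v s - w s)
      - 2 * cost ℓ u t X v := by
  obtain ⟨e, i⟩ := cost_second_diff_eq (u := u) hℓ ht hv hw X h
  rw [e]
  have i2 := hw.intervalIntegrable_norm_sq ht
  -- A bound for the squared norm of the perturbing curve, uniform in time: the concavity of the
  -- costs then loses at most `(t * c + cu) * P`.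
  set P := 2 * ‖h‖ ^ 2 + 2 * (t * energy t w) with hP
  have h1 : ∫ s in (0 : ℝ)..t, (lam * ‖w s‖ ^ 2 - c * P) ≤ _ :=
    intervalIntegral.integral_mono_on ht ((i2.const_mul lam).sub intervalIntegrable_const) i
      fun s hs => by
        refine le_trans ?_ (hℓ.lower (curve t X v s) (v s) (curve t h w s) (w s))
        have := mul_le_mul_of_nonneg_left (hw.norm_curve_sq_le hs h) hℓ.c_nonneg
        linarith
  rw [intervalIntegral.integral_sub (i2.const_mul lam) intervalIntegrable_const,
    intervalIntegral.integral_const_mul, intervalIntegral.integral_const, sub_zero,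
    smul_eq_mul] at h1
  have h2 := hu.lower (curve t X v 0) (curve t h w 0)
  have h3 := mul_le_mul_of_nonneg_left (hw.norm_curve_sq_le ⟨le_rfl, ht⟩ h) hu.c_nonneg
  have h4 : lam * energy t w - t * (c * P) - cu * P
      = (lam - 2 * t ^ 2 * c - 2 * t * cu) * energy t w - 2 * (t * c + cu) * ‖h‖ ^ 2 := by
    rw [hP]; ring
  rw [← h4]
  rw [← hP] at h3
  change lam * energy t w - _ ≤ _ at h1
  linarith

theorem cost_second_diff_le (hℓ : RegularRunningCost ℓ lam CL K c)
    (hu : RegularInitialCost u Ku cu) (ht : 0 ≤ t)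
    (hv : Admissible t v) (hw : Admissible t w) (X h : H) :
    cost ℓ u t (X + h) (fun s => v s + w s) + cost ℓ u t (X - h) (fun s => v s - w s)
      - 2 * cost ℓ u t X v
    ≤ (CL + K) * (∫ s in (0 : ℝ)..t, ‖curve t h w s‖ ^ 2) + CL * energy t w
      + Ku * ‖curve t h w 0‖ ^ 2 := by
  obtain ⟨e, i⟩ := cost_second_diff_eq (u := u) hℓ ht hv hw X h
  rw [e]
  have i2 := hw.intervalIntegrable_norm_sq ht
  have i3 : IntervalIntegrable (fun s => ‖curve t h w s‖ ^ 2) volume 0 t := by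
    refine ContinuousOn.intervalIntegrable ?_
    rw [uIcc_of_le ht]
    exact (continuousOn_curve hw ht h).norm.pow 2
  have h1 : _ ≤ ∫ s in (0 : ℝ)..t, ((CL + K) * ‖curve t h w s‖ ^ 2 + CL * ‖w s‖ ^ 2) :=
    intervalIntegral.integral_mono_on ht i ((i3.const_mul _).add (i2.const_mul CL))
      fun s hs => by
        refine (hℓ.upper (curve t X v s) (v s) (curve t h w s) (w s)).trans_eq ?_
        ring
  rw [intervalIntegral.integral_add (i3.const_mul _) (i2.const_mul CL),
    intervalIntegral.integral_const_mul, intervalIntegral.integral_const_mul] at h1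
  have h2 := hu.upper (curve t X v 0) (curve t h w 0)
  unfold energy
  linarith

end Control

/-! ### Regularity of the value function in space and time -/

section

set_option linter.unusedSectionVars false

variable {H : Type*} [NormedAddCommGroup H] [InnerProductSpace ℝ H] [CompleteSpace H]
  {ℓ : H → H → ℝ} {u : H → ℝ} {lam CL K c Ku cu t s T : ℝ} {X Y h : H} {v w : ℝ → H}

theorem exists_forall_le_cost (hℓ : RegularRunningCost ℓ lam CL K c)
    (hu : RegularInitialCost u Ku cu) (ht : 0 ≤ t) :
    ∃ m, ∀ X v, Admissible t v → m ≤ cost ℓ u t X v := by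
  obtain ⟨c₀, B, hc₀, hB0, hB⟩ := hℓ.coercive
  obtain ⟨Bu, hBu⟩ := hu.bddBelow
  refine ⟨t * (-B) + Bu, fun X v hv => ?_⟩
  have h1 : ∫ s in (0 : ℝ)..t, (-B) ≤ ∫ s in (0 : ℝ)..t, ℓ (curve t X v s) (v s) :=
    intervalIntegral.integral_mono_on ht intervalIntegrable_const
      (hℓ.intervalIntegrable_curve ht hv X) fun s hs => by
        have := hB (curve t X v s) (v s)
        have : 0 ≤ c₀ * ‖v s‖ ^ 2 := by positivity
        linarith
  rw [intervalIntegral.integral_const, sub_zero, smul_eq_mul] at h1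
  have := hBu (curve t X v 0)
  unfold cost
  linarith

theorem value_le_cost (hℓ : RegularRunningCost ℓ lam CL K c)
    (hu : RegularInitialCost u Ku cu) (ht : 0 ≤ t) (hv : Admissible t v) (X : H) :
    value ℓ u t X ≤ cost ℓ u t X v := by
  obtain ⟨m, hm⟩ := exists_forall_le_cost hℓ hu ht
  refine csInf_le ⟨m, ?_⟩ ⟨v, hv, rfl⟩
  rintro _ ⟨v, hv, rfl⟩
  exact hm X v hv

theorem le_value {a : ℝ} (h : ∀ v, Admissible t v → a ≤ cost ℓ u t X v) :
    a ≤ value ℓ u t X := by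
  refine le_csInf ⟨_, fun _ => 0, admissible_const t 0, rfl⟩ ?_
  rintro _ ⟨v, hv, rfl⟩
  exact h v hv

theorem value_second_diff_le (hℓ : RegularRunningCost ℓ lam CL K c)
    (hu : RegularInitialCost u Ku cu) (ht : 0 ≤ t) (hw : Admissible t w) (X h : H) :
    value ℓ u t (X + h) + value ℓ u t (X - h) - 2 * value ℓ u t X
    ≤ (CL + K) * (∫ s in (0 : ℝ)..t, ‖curve t h w s‖ ^ 2) + CL * energy t w
      + Ku * ‖curve t h w 0‖ ^ 2 := by
  set R := (CL + K) * (∫ s in (0 : ℝ)..t, ‖curve t h w s‖ ^ 2) + CL * energy t w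
      + Ku * ‖curve t h w 0‖ ^ 2
  have : (value ℓ u t (X + h) + value ℓ u t (X - h) - R) / 2 ≤ value ℓ u t X := by
    refine le_value fun v hv => ?_
    have h1 := cost_second_diff_le hℓ hu ht hv hw X h
    have h2 := value_le_cost hℓ hu ht (hv.add hw) (X + h)
    have h3 := value_le_cost hℓ hu ht (hv.sub hw) (X - h)
    linarith
  linarith

/-- Uses `w = 0`, a rigid translation of the curve by `h`; the constant stays bounded as `t → 0`. -/
theorem value_second_diff_le_uniform (hℓ : RegularRunningCost ℓ lam CL K c)
    (hu : RegularInitialCost u Ku cu) (ht : 0 ≤ t) (X h : H) :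
    value ℓ u t (X + h) + value ℓ u t (X - h) - 2 * value ℓ u t X
    ≤ (t * (CL + K) + Ku) * ‖h‖ ^ 2 := by
  refine (value_second_diff_le hℓ hu ht (admissible_const t 0) X h).trans_eq ?_
  simp [curve, energy]
  ring

/-- Uses the linear ramp `(s / t) • h`: it vanishes at time `0`, so the initial cost does not
contribute, and its squared norm integrates to `t / 3 * ‖h‖ ^ 2`. -/
theorem value_second_diff_le_div (hℓ : RegularRunningCost ℓ lam CL K c)
    (hu : RegularInitialCost u Ku cu) (ht : 0 < t) (X h : H) :
    value ℓ u t (X + h) + value ℓ u t (X - h) - 2 * value ℓ u t X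
    ≤ (t / 3 * (CL + K) + CL / t) * ‖h‖ ^ 2 := by
  refine (value_second_diff_le hℓ hu ht.le (admissible_const t (t⁻¹ • h)) X h).trans_eq ?_
  have e1 : ∀ s, curve t h (fun _ => t⁻¹ • h) s = (s / t) • h := fun s => by
    unfold curve
    rw [intervalIntegral.integral_const, smul_smul, ← one_smul ℝ h, smul_smul, ← sub_smul]
    congr 1
    · field_simp; ring
    · simp
  have e2 : ∫ s in (0 : ℝ)..t, ‖(s / t) • h‖ ^ 2 = t / 3 * ‖h‖ ^ 2 := by
    have : ∀ s : ℝ, ‖(s / t) • h‖ ^ 2 = (‖h‖ ^ 2 / t ^ 2) * s ^ 2 := fun s => by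
      rw [norm_smul, mul_pow, Real.norm_eq_abs, sq_abs]; field_simp
    simp_rw [this]
    rw [intervalIntegral.integral_const_mul, integral_pow]
    field_simp
    norm_num
  have e3 : energy t (fun _ => t⁻¹ • h) = ‖h‖ ^ 2 / t := by
    unfold energy
    rw [intervalIntegral.integral_const, norm_smul, mul_pow, Real.norm_eq_abs, sq_abs, sub_zero,
      smul_eq_mul]
    field_simp
  simp_rw [e1]
  rw [e2, e3]
  simp
  ring

theorem value_second_diff_ge (hℓ : RegularRunningCost ℓ lam CL K c)
    (hu : RegularInitialCost u Ku cu) (ht : 0 ≤ t)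
    (hα : 0 ≤ lam - 2 * t ^ 2 * c - 2 * t * cu) (X h : H) :
    -(2 * (t * c + cu)) * ‖h‖ ^ 2
    ≤ value ℓ u t (X + h) + value ℓ u t (X - h) - 2 * value ℓ u t X := by
  have h1 : 2 * value ℓ u t X - 2 * (t * c + cu) * ‖h‖ ^ 2 - value ℓ u t (X - h)
      ≤ value ℓ u t (X + h) := by
    refine le_value fun v₁ hv₁ => ?_
    suffices 2 * value ℓ u t X - 2 * (t * c + cu) * ‖h‖ ^ 2 - cost ℓ u t (X + h) v₁
        ≤ value ℓ u t (X - h) by linarith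
    refine le_value fun v₂ hv₂ => ?_
    -- The mean velocity competes for `X`; the half difference plays the role of the perturbation
    -- `w`.
    have hv := (hv₁.add hv₂).const_smul (1 / 2)
    have hw := (hv₁.sub hv₂).const_smul (1 / 2)
    have k1 := cost_second_diff_ge hℓ hu ht hv hw X h
    have k2 := value_le_cost hℓ hu ht hv X
    have k3 := mul_nonneg hα (energy_nonneg (v := fun s => (1 / 2 : ℝ) • (v₁ s - v₂ s)) ht)
    have e1 : (fun s => (1 / 2 : ℝ) • (v₁ s + v₂ s) + (1 / 2 : ℝ) • (v₁ s - v₂ s)) = v₁ := by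
      funext s; module
    have e2 : (fun s => (1 / 2 : ℝ) • (v₁ s + v₂ s) - (1 / 2 : ℝ) • (v₁ s - v₂ s)) = v₂ := by
      funext s; module
    rw [e1, e2] at k1
    linarith
  linarith

/-- A constant valid down to `t = 0`, needed to vary `t`; hence translations rather than ramps,
whose cost `CL / t` blows up. -/
theorem exists_abs_value_second_diff_le (hℓ : RegularRunningCost ℓ lam CL K c)
    (hu : RegularInitialCost u Ku cu)
    (hα : ∀ t ∈ Icc 0 T, 0 < lam - 2 * t ^ 2 * c - 2 * t * cu) :
    ∃ D, 0 ≤ D ∧ ∀ t ∈ Icc 0 T, ∀ X h,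
      |value ℓ u t (X + h) + value ℓ u t (X - h) - 2 * value ℓ u t X| ≤ D * ‖h‖ ^ 2 := by
  rcases lt_or_ge T 0 with hT | hT
  · exact ⟨0, le_rfl, fun t ht => absurd (ht.1.trans ht.2) (not_le.2 hT)⟩
  have := hℓ.K_nonneg
  have := hu.K_nonneg
  have := hℓ.c_nonneg
  have := hu.c_nonneg
  refine ⟨T * (|CL| + K) + Ku + 2 * (T * c + cu), by positivity, fun t ht X h => ?_⟩
  have h1 := value_second_diff_le_uniform hℓ hu ht.1 X h
  have h2 := value_second_diff_ge hℓ hu ht.1 (hα t ht).le X h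
  have e1 : (t * (CL + K) + Ku) * ‖h‖ ^ 2 ≤ (T * (|CL| + K) + Ku) * ‖h‖ ^ 2 := by
    have a1 : t * (CL + K) ≤ t * (|CL| + K) :=
      mul_le_mul_of_nonneg_left (by linarith [le_abs_self CL]) ht.1
    have a2 : t * (|CL| + K) ≤ T * (|CL| + K) :=
      mul_le_mul_of_nonneg_right ht.2 (by positivity)
    exact mul_le_mul_of_nonneg_right (by linarith) (by positivity)
  have e2 : 2 * (t * c + cu) * ‖h‖ ^ 2 ≤ 2 * (T * c + cu) * ‖h‖ ^ 2 := by
    have := ht.2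
    gcongr
  have p1 : 0 ≤ (T * (|CL| + K) + Ku) * ‖h‖ ^ 2 := by positivity
  have p2 : 0 ≤ 2 * (T * c + cu) * ‖h‖ ^ 2 := by positivity
  rw [abs_le]
  constructor <;> linarith

theorem exists_abs_value_sub_le (hℓ : RegularRunningCost ℓ lam CL K c)
    (hu : RegularInitialCost u Ku cu) (hT : 0 ≤ T) :
    ∃ Λ, 0 ≤ Λ ∧ ∀ t ∈ Icc 0 T, ∀ X Y, |value ℓ u t X - value ℓ u t Y| ≤ Λ * ‖X - Y‖ := by
  obtain ⟨Λ, hΛ0, hΛ⟩ := hℓ.lipschitz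
  obtain ⟨Λu, hΛu0, hΛu⟩ := hu.lipschitz
  refine ⟨T * Λ + Λu, by positivity, fun t ht X Y => ?_⟩
  -- The same velocity is used for both endpoints, so the two curves differ by the constant `X - Y`.
  have key : ∀ X Y, value ℓ u t X - (T * Λ + Λu) * ‖X - Y‖ ≤ value ℓ u t Y := by
    intro X Y
    refine le_value fun v hv => ?_
    refine (sub_le_sub_right (value_le_cost hℓ hu ht.1 hv X) _).trans ?_
    have h1 : ∫ s in (0 : ℝ)..t, (ℓ (curve t X v s) (v s) - ℓ (curve t Y v s) (v s))
        ≤ ∫ s in (0 : ℝ)..t, Λ * ‖X - Y‖ :=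
      intervalIntegral.integral_mono_on ht.1
        ((hℓ.intervalIntegrable_curve ht.1 hv X).sub (hℓ.intervalIntegrable_curve ht.1 hv Y))
        intervalIntegrable_const fun s _ => by
          have := hΛ (curve t X v s) (curve t Y v s) (v s)
          rw [curve_sub_curve] at this
          exact (le_abs_self _).trans this
    rw [intervalIntegral.integral_sub (hℓ.intervalIntegrable_curve ht.1 hv X)
      (hℓ.intervalIntegrable_curve ht.1 hv Y), intervalIntegral.integral_const, sub_zero,
      smul_eq_mul] at h1
    have h2 := (le_abs_self _).trans (hΛu (curve t X v 0) (curve t Y v 0))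
    rw [curve_sub_curve] at h2
    have h3 : t * (Λ * ‖X - Y‖) ≤ T * (Λ * ‖X - Y‖) :=
      mul_le_mul_of_nonneg_right ht.2 (by positivity)
    unfold cost
    linarith
  have h1 := key X Y
  have h2 := key Y X
  rw [norm_sub_rev] at h2
  rw [abs_le]
  constructor <;> linarith

theorem curve_curve (hv : Admissible t v) (hs : s ∈ Icc 0 t) {r : ℝ} (hr : r ∈ Icc 0 s) (X : H) :
    curve s (curve t X v s) v r = curve t X v r := by
  have h1 : IntervalIntegrable v volume r s := (hv.mono hs.2).intervalIntegrable_right hr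
  have h2 : IntervalIntegrable v volume s t := hv.intervalIntegrable_right hs
  unfold curve
  rw [← intervalIntegral.integral_add_adjacent_intervals h1 h2]
  abel

/-- The cost splits at an intermediate time. -/
theorem cost_split (hℓ : RegularRunningCost ℓ lam CL K c) (hv : Admissible t v)
    (hs : s ∈ Icc 0 t) (X : H) :
    cost ℓ u t X v = cost ℓ u s (curve t X v s) v
      + ∫ r in s..t, ℓ (curve t X v r) (v r) := by
  have ht := hs.1.trans hs.2
  have i := hℓ.intervalIntegrable_curve ht hv X
  have i1 : IntervalIntegrable (fun r => ℓ (curve t X v r) (v r)) volume 0 s :=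
    i.mono_set (by rw [uIcc_of_le hs.1, uIcc_of_le ht]; exact Icc_subset_Icc_right hs.2)
  have i2 : IntervalIntegrable (fun r => ℓ (curve t X v r) (v r)) volume s t :=
    i.mono_set (by rw [uIcc_of_le hs.2, uIcc_of_le ht]; exact Icc_subset_Icc_left hs.1)
  unfold cost
  rw [← intervalIntegral.integral_add_adjacent_intervals i1 i2,
    curve_curve hv hs ⟨le_rfl, hs.1⟩]
  have e : ∫ r in (0 : ℝ)..s, ℓ (curve s (curve t X v s) v r) (v r)
      = ∫ r in (0 : ℝ)..s, ℓ (curve t X v r) (v r) :=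
    intervalIntegral.integral_congr fun r hr => by
      rw [uIcc_of_le hs.1] at hr
      simp only [curve_curve hv hs hr]
  rw [e]; ring

theorem value_add_integral_le_cost (hℓ : RegularRunningCost ℓ lam CL K c)
    (hu : RegularInitialCost u Ku cu) (hv : Admissible t v) (hs : s ∈ Icc 0 t) (X : H) :
    value ℓ u s (curve t X v s) + ∫ r in s..t, ℓ (curve t X v r) (v r) ≤ cost ℓ u t X v := by
  rw [cost_split hℓ hv hs]
  gcongr
  exact value_le_cost hℓ hu hs.1 (hv.mono hs.2) _

/-- Dynamic programming with a straight line as the last piece. -/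
theorem value_le_add_integral (hℓ : RegularRunningCost ℓ lam CL K c)
    (hu : RegularInitialCost u Ku cu) (hs : s ∈ Icc 0 t) (X V : H) :
    value ℓ u t X ≤ value ℓ u s (X - (t - s) • V)
      + ∫ r in s..t, ℓ (X - (t - r) • V) V := by
  suffices value ℓ u t X - (∫ r in s..t, ℓ (X - (t - r) • V) V)
      ≤ value ℓ u s (X - (t - s) • V) by linarith
  refine le_value fun v hv => ?_
  classical
  -- Any competitor up to time `s`, continued with constant velocity `V`.
  set v' : ℝ → H := (Iic s).piecewise v (fun _ => V) with hv'
  have hadm : Admissible t v' := by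
    refine MemLp.piecewise measurableSet_Iic ?_ (memLp_const V)
    rw [Measure.restrict_restrict measurableSet_Iic]
    refine MemLp.mono_measure (Measure.restrict_mono ?_ le_rfl) hv
    exact fun r hr => ⟨hr.2.1, hr.1⟩
  have hright : ∀ r ∈ Icc s t, curve t X v' r = X - (t - r) • V := by
    intro r hr
    unfold curve
    rw [← intervalIntegral.integral_const]
    congr 1
    rw [intervalIntegral.integral_of_le hr.2, intervalIntegral.integral_of_le hr.2]
    refine setIntegral_congr_fun measurableSet_Ioc fun a ha => ?_
    exact piecewise_eq_of_notMem _ _ _ (by simpa using hr.1.trans_lt ha.1)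
  have e1 : cost ℓ u s (X - (t - s) • V) v' = cost ℓ u s (X - (t - s) • V) v := by
    refine cost_congr hs.1 ?_
    filter_upwards [ae_restrict_mem measurableSet_Ioc] with r hr
    exact piecewise_eq_of_mem _ _ _ hr.2
  have e2 : ∫ r in s..t, ℓ (curve t X v' r) (v' r) = ∫ r in s..t, ℓ (X - (t - r) • V) V := by
    rw [intervalIntegral.integral_of_le hs.2, intervalIntegral.integral_of_le hs.2]
    refine setIntegral_congr_fun measurableSet_Ioc fun a ha => ?_
    have : v' a = V := piecewise_eq_of_notMem _ _ _ (by simpa using ha.1)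
    simp only [hright a ⟨ha.1.le, ha.2⟩, this]
  have h1 := value_le_cost hℓ hu (hs.1.trans hs.2) hadm X
  rw [cost_split hℓ hadm hs, hright s ⟨le_rfl, hs.2⟩, e1, e2] at h1
  linarith

/-- Standing still on `[s, t]` gives one direction. For the other, whatever a competitor gains by
moving on `[s, t]` is at most `Λ` times its displacement, and coercivity pays for that up to `O(t -
s)`. -/
theorem exists_abs_value_sub_value_le (hℓ : RegularRunningCost ℓ lam CL K c)
    (hu : RegularInitialCost u Ku cu) (hT : 0 ≤ T) :
    ∃ M, 0 ≤ M ∧ ∀ t ∈ Icc 0 T, ∀ s ∈ Icc 0 T, ∀ X,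
      |value ℓ u t X - value ℓ u s X| ≤ M * (1 + ‖X‖) * |t - s| := by
  obtain ⟨Λ, hΛ0, hΛ⟩ := exists_abs_value_sub_le hℓ hu hT
  obtain ⟨c₀, B, hc₀, hB0, hB⟩ := hℓ.coercive
  obtain ⟨A, hA0, hA⟩ := hℓ.growth
  refine ⟨A + B + Λ ^ 2 / (4 * c₀), by positivity, ?_⟩
  set M := A + B + Λ ^ 2 / (4 * c₀) with hM
  have key : ∀ s t, 0 ≤ s → s ≤ t → t ≤ T → ∀ X,
      |value ℓ u t X - value ℓ u s X| ≤ M * (1 + ‖X‖) * (t - s) := by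
    intro s t hs0 hst htT X
    have hs : s ∈ Icc 0 t := ⟨hs0, hst⟩
    have hts : 0 ≤ t - s := sub_nonneg.2 hst
    have hx := norm_nonneg X
    rw [abs_le]
    constructor
    · suffices value ℓ u s X - (B + Λ ^ 2 / (4 * c₀)) * (t - s) ≤ value ℓ u t X by
        have h1 : (B + Λ ^ 2 / (4 * c₀)) * (t - s) ≤ M * (1 + ‖X‖) * (t - s) := by
          have h2 : B + Λ ^ 2 / (4 * c₀) ≤ M := by linarith
          have h3 : M ≤ M * (1 + ‖X‖) := by
            have : 0 ≤ M := by positivity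
            nlinarith
          exact mul_le_mul_of_nonneg_right (h2.trans h3) hts
        linarith
      refine le_value fun v hv => le_trans ?_ (value_add_integral_le_cost hℓ hu hv hs X)
      have h1 := (abs_le.1 (hΛ s ⟨hs0, hst.trans htT⟩ (curve t X v s) X)).1
      have h2 := hv.norm_integral_sq_le hs
      have e : ‖curve t X v s - X‖ = ‖∫ r in s..t, v r‖ := by
        unfold curve; rw [← norm_neg]; congr 1; abel
      rw [e] at h1
      set n := ‖∫ r in s..t, v r‖ with hn
      set Es := ∫ r in s..t, ‖v r‖ ^ 2 with hEs
      have i := hℓ.intervalIntegrable_curve (hs0.trans hst) hv X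
      have i2 : IntervalIntegrable (fun r => ℓ (curve t X v r) (v r)) volume s t :=
        i.mono_set (by
          rw [uIcc_of_le hs.2, uIcc_of_le (hs0.trans hst)]; exact Icc_subset_Icc_left hs.1)
      have i3 := hv.intervalIntegrable_norm_sq_right hs
      have h3 : ∫ r in s..t, (c₀ * ‖v r‖ ^ 2 - B) ≤ ∫ r in s..t, ℓ (curve t X v r) (v r) :=
        intervalIntegral.integral_mono_on hst ((i3.const_mul c₀).sub intervalIntegrable_const)
          i2 fun r _ => hB _ _
      rw [intervalIntegral.integral_sub (i3.const_mul c₀) intervalIntegrable_const,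
        intervalIntegral.integral_const_mul, intervalIntegral.integral_const, smul_eq_mul] at h3
      -- Young's inequality, with `n ^ 2 ≤ (t - s) * Es`.
      have h4 : Λ * n ≤ c₀ * Es + Λ ^ 2 / (4 * c₀) * (t - s) := by
        have hEs0 : 0 ≤ Es := intervalIntegral.integral_nonneg hst fun _ _ => by positivity
        have hn0 : 0 ≤ n := norm_nonneg _
        refine abs_le_of_sq_le_sq' ?_ (by positivity) |>.2
        have h5 : 4 * (c₀ * Es) * (Λ ^ 2 / (4 * c₀) * (t - s)) = Λ ^ 2 * ((t - s) * Es) := by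
          field_simp
        have h6 : (Λ * n) ^ 2 ≤ Λ ^ 2 * ((t - s) * Es) := by
          rw [mul_pow]; gcongr
        nlinarith [sq_nonneg (c₀ * Es - Λ ^ 2 / (4 * c₀) * (t - s))]
      linarith
    · have h1 := value_le_add_integral hℓ hu hs X 0
      simp only [smul_zero, sub_zero, intervalIntegral.integral_const, smul_eq_mul] at h1
      have h2 := hA X 0
      simp only [norm_zero] at h2
      have h3 : A * (1 + ‖X‖ + 0 ^ 2) ≤ M * (1 + ‖X‖) := by
        have : A ≤ M := by
          have : 0 ≤ Λ ^ 2 / (4 * c₀) := by positivity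
          linarith
        have : A * (1 + ‖X‖) ≤ M * (1 + ‖X‖) := by gcongr
        simpa using this
      have h4 := mul_le_mul_of_nonneg_left (h2.trans h3) hts
      linarith
  intro t ht s hs X
  rcases le_total s t with hst | hst
  · rw [abs_of_nonneg (sub_nonneg.2 hst)]
    exact key s t hs.1 hst ht.2 X
  · rw [abs_sub_comm, abs_sub_comm t s, abs_of_nonneg (sub_nonneg.2 hst)]
    exact key t s ht.1 hst hs.2 X

theorem differentiable_value (hℓ : RegularRunningCost ℓ lam CL K c)
    (hu : RegularInitialCost u Ku cu)
    (hα : ∀ t ∈ Icc 0 T, 0 < lam - 2 * t ^ 2 * c - 2 * t * cu) (ht : t ∈ Icc 0 T) :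
    Differentiable ℝ (value ℓ u t) := by
  obtain ⟨D, -, hD⟩ := exists_abs_value_second_diff_le hℓ hu hα
  obtain ⟨Λ, hΛ0, hΛ⟩ := exists_abs_value_sub_le hℓ hu (ht.1.trans ht.2)
  refine differentiable_of_abs_second_diff_le (hD t ht) fun X =>
    ⟨1, one_pos, |value ℓ u t X| + Λ, fun h hh => ?_⟩
  have h1 := hΛ t ht (X + h) X
  rw [add_sub_cancel_left] at h1
  have h2 : Λ * ‖h‖ ≤ Λ := mul_le_of_le_one_right hΛ0 hh
  have h3 := abs_sub_abs_le_abs_sub (value ℓ u t (X + h)) (value ℓ u t X)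
  linarith

/-- The gradient of the value function is jointly continuous. -/
theorem continuousOn_gradient_value (hℓ : RegularRunningCost ℓ lam CL K c)
    (hu : RegularInitialCost u Ku cu)
    (hα : ∀ t ∈ Icc 0 T, 0 < lam - 2 * t ^ 2 * c - 2 * t * cu) :
    ContinuousOn (fun p : ℝ × H => gradient (value ℓ u p.1) p.2) (Icc 0 T ×ˢ univ) := by
  rintro ⟨t₀, X₀⟩ ⟨ht₀ : t₀ ∈ Icc 0 T, -⟩
  obtain ⟨D, hD0, hD⟩ := exists_abs_value_second_diff_le hℓ hu hα
  obtain ⟨M, hM0, hM⟩ := exists_abs_value_sub_value_le hℓ hu (ht₀.1.trans ht₀.2)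
  have hdiff : ∀ t ∈ Icc 0 T, Differentiable ℝ (value ℓ u t) := fun t ht =>
    differentiable_value hℓ hu hα ht
  have hgrad : ∀ t ∈ Icc 0 T, ‖gradient (value ℓ u t) X₀ - gradient (value ℓ u t₀) X₀‖
      ≤ (M * (1 + ‖X₀‖) + M * (1 + (‖X₀‖ + √|t - t₀|)) + D) * √|t - t₀| := by
    intro t ht
    set g := gradient (value ℓ u t) X₀ - gradient (value ℓ u t₀) X₀ with hg
    set r := √|t - t₀| with hr
    have hr0 : 0 ≤ r := Real.sqrt_nonneg _
    have hr2 : |t - t₀| = r * r := (Real.mul_self_sqrt (abs_nonneg _)).symm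
    rcases eq_or_lt_of_le hr0 with h0 | h0
    · have : t = t₀ := sub_eq_zero.1 (abs_eq_zero.1 (by rw [hr2, ← h0, mul_zero]))
      have hg0 : g = 0 := by rw [hg, this, sub_self]
      rw [hg0, norm_zero]; positivity
    rcases eq_or_ne g 0 with hg0 | hg0
    · rw [hg0, norm_zero]; positivity
    have hgn : 0 < ‖g‖ := norm_pos_iff.2 hg0
    -- Interpolation: a step of length `r` along `g` bounds `‖g‖` by a time error of order `|t - t₀|
    -- / r` plus the remainder `D * r`; the choice `r = √|t - t₀|` balances them.
    set h := (r / ‖g‖) • g with hh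
    have hhn : ‖h‖ = r := by
      rw [hh, norm_smul, Real.norm_of_nonneg (by positivity)]; field_simp
    have k1 := (abs_le.1 (abs_sub_inner_gradient_le (hD t ht) (hdiff t ht) X₀ h)).1
    have k2 := (abs_le.1 (abs_sub_inner_gradient_le (hD t₀ ht₀) (hdiff t₀ ht₀) X₀ h)).2
    have k3 := (abs_le.1 (hM t ht t₀ ht₀ (X₀ + h))).2
    have k4 := (abs_le.1 (hM t ht t₀ ht₀ X₀)).1
    have hin : inner ℝ (gradient (value ℓ u t) X₀) h - inner ℝ (gradient (value ℓ u t₀) X₀) h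
        = r * ‖g‖ := by
      rw [← inner_sub_left, ← hg, hh, inner_smul_right, real_inner_self_eq_norm_sq]; field_simp
    rw [hhn] at k1 k2
    have k5 : M * (1 + ‖X₀ + h‖) * |t - t₀| ≤ M * (1 + (‖X₀‖ + r)) * |t - t₀| := by
      have : ‖X₀ + h‖ ≤ ‖X₀‖ + r := (norm_add_le _ _).trans_eq (by rw [hhn])
      gcongr
    rw [hr2] at k3 k4 k5
    have k6 : r * ‖g‖ ≤ r * ((M * (1 + ‖X₀‖) + M * (1 + (‖X₀‖ + r)) + D) * r) := by
      linarith
    exact le_of_mul_le_mul_left k6 h0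
  have hbd : ∀ p ∈ Icc 0 T ×ˢ (univ : Set H),
      ‖gradient (value ℓ u p.1) p.2 - gradient (value ℓ u t₀) X₀‖ ≤ D * ‖p.2 - X₀‖
        + (M * (1 + ‖X₀‖) + M * (1 + (‖X₀‖ + √|p.1 - t₀|)) + D) * √|p.1 - t₀| := by
    rintro ⟨t, X⟩ ⟨ht : t ∈ Icc 0 T, -⟩
    have h1 := norm_gradient_sub_le (hD t ht) (hdiff t ht) X X₀
    have h2 := hgrad t ht
    have h3 := norm_sub_le_norm_sub_add_norm_sub (gradient (value ℓ u t) X)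
      (gradient (value ℓ u t) X₀) (gradient (value ℓ u t₀) X₀)
    exact h3.trans (add_le_add h1 h2)
  have hlim : Tendsto (fun p : ℝ × H => D * ‖p.2 - X₀‖
        + (M * (1 + ‖X₀‖) + M * (1 + (‖X₀‖ + √|p.1 - t₀|)) + D) * √|p.1 - t₀|)
      (𝓝[Icc 0 T ×ˢ univ] (t₀, X₀)) (𝓝 0) := by
    have : Continuous fun p : ℝ × H => D * ‖p.2 - X₀‖
        + (M * (1 + ‖X₀‖) + M * (1 + (‖X₀‖ + √|p.1 - t₀|)) + D) * √|p.1 - t₀| := by fun_prop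
    have h1 := this.tendsto (t₀, X₀)
    simp only [sub_self, norm_zero, abs_zero, Real.sqrt_zero, mul_zero, add_zero] at h1
    exact h1.mono_left nhdsWithin_le_nhds
  rw [ContinuousWithinAt, tendsto_iff_norm_sub_tendsto_zero]
  refine squeeze_zero' (Eventually.of_forall fun _ => norm_nonneg _) ?_ hlim
  filter_upwards [self_mem_nhdsWithin] with p hp using hbd p hp

end

/-! ### Existence of minimizers and their velocity at the endpoint -/

section

set_option linter.unusedSectionVars false

variable {H : Type*} [NormedAddCommGroup H] [InnerProductSpace ℝ H] [CompleteSpace H]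
  {ℓ : H → H → ℝ} {u : H → ℝ} {lam CL K c Ku cu t s T : ℝ} {X Y h : H} {v w : ℝ → H}

/-- Supplies the local upper bound needed to prove the cost continuous on `L²` velocities. -/
theorem exists_cost_le (hℓ : RegularRunningCost ℓ lam CL K c)
    (hu : RegularInitialCost u Ku cu) (ht : 0 ≤ t) (X : H) :
    ∃ a, 0 ≤ a ∧ ∀ v, Admissible t v → cost ℓ u t X v ≤ a * (1 + energy t v) := by
  obtain ⟨A, hA0, hA⟩ := hℓ.growth
  obtain ⟨Λ, hΛ0, hΛ⟩ := hu.lipschitz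
  set G := 1 + 2 * ‖X‖ ^ 2 with hG
  refine ⟨t * A * (1 + G) + t * A * (2 * t) + A + |u 0| + Λ * G + Λ * (2 * t),
    by positivity, fun v hv => ?_⟩
  have hE := energy_nonneg (v := v) ht
  have hb : ∀ s ∈ Icc 0 t, ‖curve t X v s‖ ≤ G + 2 * t * energy t v := fun s hs => by
    have := hv.norm_curve_sq_le hs X
    nlinarith [sq_nonneg (‖curve t X v s‖ - 1), norm_nonneg (curve t X v s)]
  have i2 := hv.intervalIntegrable_norm_sq ht
  have h1 : ∫ s in (0 : ℝ)..t, ℓ (curve t X v s) (v s)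
      ≤ ∫ s in (0 : ℝ)..t, (A * (1 + (G + 2 * t * energy t v)) + A * ‖v s‖ ^ 2) :=
    intervalIntegral.integral_mono_on ht (hℓ.intervalIntegrable_curve ht hv X)
      (intervalIntegrable_const.add (i2.const_mul A)) fun s hs => by
        refine (hA _ _).trans ?_
        have := mul_le_mul_of_nonneg_left (hb s hs) hA0
        linarith
  rw [intervalIntegral.integral_add intervalIntegrable_const (i2.const_mul A),
    intervalIntegral.integral_const, intervalIntegral.integral_const_mul, sub_zero,
    smul_eq_mul] at h1
  change _ ≤ _ + A * energy t v at h1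
  have h2 := (le_abs_self _).trans (hΛ (curve t X v 0) 0)
  rw [sub_zero] at h2
  have h3 := mul_le_mul_of_nonneg_left (hb 0 ⟨le_rfl, ht⟩) hΛ0
  have h4 := le_abs_self (u 0)
  set E := energy t v
  have p1 : 0 ≤ t * A * (1 + G) * E := by positivity
  have p2 : 0 ≤ t * A * (2 * t) := by positivity
  have p3 : 0 ≤ |u 0| * E := by positivity
  have p4 : 0 ≤ Λ * G * E := by positivity
  have p5 : 0 ≤ Λ * (2 * t) := by positivity
  unfold cost
  nlinarith

theorem energy_coe (ht : 0 ≤ t) (w : Lp H 2 (volume.restrict (Ioc 0 t))) :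
    energy t w = ‖w‖ ^ 2 := by
  rw [← real_inner_self_eq_norm_sq, L2.inner_def, energy, intervalIntegral.integral_of_le ht]
  simp_rw [real_inner_self_eq_norm_sq]

/-- Minimizing velocities exist, by uniform convexity of the cost. -/
theorem exists_cost_eq_value (hℓ : RegularRunningCost ℓ lam CL K c)
    (hu : RegularInitialCost u Ku cu) (ht : 0 ≤ t)
    (hα : 0 < lam - 2 * t ^ 2 * c - 2 * t * cu) (X : H) :
    ∃ v, Admissible t v ∧ cost ℓ u t X v = value ℓ u t X := by
  let f : Lp H 2 (volume.restrict (Ioc 0 t)) → ℝ := fun v => cost ℓ u t X v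
  have hadm : ∀ v : Lp H 2 (volume.restrict (Ioc 0 t)), Admissible t v := fun v => Lp.memLp v
  have hadd : ∀ v w, f (v + w) = cost ℓ u t (X + 0) (fun s => v s + w s) := fun v w => by
    rw [add_zero]; exact cost_congr ht (Lp.coeFn_add v w)
  have hsub : ∀ v w, f (v - w) = cost ℓ u t (X - 0) (fun s => v s - w s) := fun v w => by
    rw [sub_zero]; exact cost_congr ht (Lp.coeFn_sub v w)
  obtain ⟨m, hm⟩ := exists_forall_le_cost hℓ hu ht
  obtain ⟨a, ha0, ha⟩ := exists_cost_le hℓ hu ht X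
  -- With the endpoint held fixed (`h = 0`), the cost is uniformly convex in the velocity.
  have hlow : ∀ v w, (lam - 2 * t ^ 2 * c - 2 * t * cu) * ‖w‖ ^ 2
      ≤ f (v + w) + f (v - w) - 2 * f v := fun v w => by
    have := cost_second_diff_ge hℓ hu ht (hadm v) (hadm w) X 0
    rw [← hadd, ← hsub, energy_coe ht] at this
    simpa using this
  have hup : ∀ v w, f (v + w) + f (v - w) - 2 * f v
      ≤ ((|CL| + K) * (t * (2 * t)) + |CL| + Ku * (2 * t)) * ‖w‖ ^ 2 := fun v w => by
    have h1 := cost_second_diff_le hℓ hu ht (hadm v) (hadm w) X 0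
    rw [← hadd, ← hsub] at h1
    have hb : ∀ s ∈ Icc 0 t, ‖curve t 0 w s‖ ^ 2 ≤ 2 * (t * ‖w‖ ^ 2) := fun s hs => by
      have := (hadm w).norm_curve_sq_le hs 0
      rw [energy_coe ht] at this
      simpa using this
    have h2 : ∫ s in (0 : ℝ)..t, ‖curve t 0 w s‖ ^ 2 ≤ ∫ s in (0 : ℝ)..t, 2 * (t * ‖w‖ ^ 2) :=
      intervalIntegral.integral_mono_on ht (by
        refine ContinuousOn.intervalIntegrable ?_
        rw [uIcc_of_le ht]
        exact (continuousOn_curve (hadm w) ht 0).norm.pow 2) intervalIntegrable_const hb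
    rw [intervalIntegral.integral_const, sub_zero, smul_eq_mul] at h2
    have h0 : 0 ≤ ∫ s in (0 : ℝ)..t, ‖curve t 0 w s‖ ^ 2 :=
      intervalIntegral.integral_nonneg ht fun _ _ => by positivity
    have h3 := mul_le_mul_of_nonneg_left (hb 0 ⟨le_rfl, ht⟩) hu.K_nonneg
    rw [energy_coe ht] at h1
    have h4 : (CL + K) * (∫ s in (0 : ℝ)..t, ‖curve t 0 w s‖ ^ 2)
        ≤ (|CL| + K) * (t * (2 * (t * ‖w‖ ^ 2))) :=
      (mul_le_mul_of_nonneg_right (by linarith [le_abs_self CL]) h0).trans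
        (mul_le_mul_of_nonneg_left h2 (by linarith [abs_nonneg CL, hℓ.K_nonneg]))
    have h5 : CL * ‖w‖ ^ 2 ≤ |CL| * ‖w‖ ^ 2 :=
      mul_le_mul_of_nonneg_right (le_abs_self CL) (by positivity)
    linarith
  have hcont : Continuous f := by
    refine (differentiable_of_abs_second_diff_le
      (C := (|CL| + K) * (t * (2 * t)) + |CL| + Ku * (2 * t)) (fun v w => ?_)
      fun v => ⟨1, one_pos, |m| + a * (1 + (‖v‖ + 1) ^ 2), fun w hw => ?_⟩).continuous
    · rw [abs_of_nonneg]
      · exact hup v w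
      · exact (mul_nonneg hα.le (by positivity)).trans (hlow v w)
    · have h1 := hm X _ (hadm (v + w))
      have h2 := ha _ (hadm (v + w))
      rw [energy_coe ht] at h2
      have h3 : a * (1 + ‖v + w‖ ^ 2) ≤ a * (1 + (‖v‖ + 1) ^ 2) := by
        have : ‖v + w‖ ≤ ‖v‖ + 1 := (norm_add_le _ _).trans (by linarith)
        gcongr
      have h4 := neg_abs_le m
      have h5 : 0 ≤ a * (1 + (‖v‖ + 1) ^ 2) := by positivity
      have h6 := abs_nonneg m
      rw [abs_le]
      constructor
      · change _ ≤ cost ℓ u t X (v + w : Lp H 2 (volume.restrict (Ioc 0 t)))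
        linarith
      · change cost ℓ u t X (v + w : Lp H 2 (volume.restrict (Ioc 0 t))) ≤ _
        linarith
  obtain ⟨v, hv⟩ := exists_forall_le_of_le_second_diff hcont hα
    ⟨m, by rintro _ ⟨v, rfl⟩; exact hm X _ (hadm v)⟩ hlow
  refine ⟨v, hadm v, le_antisymm (le_value fun w hw => ?_) (value_le_cost hℓ hu ht (hadm v) X)⟩
  refine (hv (MemLp.toLp w hw)).trans_eq ?_
  exact cost_congr ht (MemLp.coeFn_toLp hw)

/-- Comparison of an optimal curve with a straight line near the end point. -/
theorem endpoint_estimate (hℓ : RegularRunningCost ℓ lam CL K c)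
    (hu : RegularInitialCost u Ku cu) {D Λ : ℝ} (hD0 : 0 ≤ D) (hs : s ∈ Icc 0 t)
    (hD : ∀ X h, |value ℓ u s (X + h) + value ℓ u s (X - h) - 2 * value ℓ u s X| ≤ D * ‖h‖ ^ 2)
    (hdiff : Differentiable ℝ (value ℓ u s))
    (hΛ0 : 0 ≤ Λ) (hΛ : ∀ x y v, |ℓ x v - ℓ y v| ≤ Λ * ‖x - y‖)
    (hv : Admissible t v) (hmin : cost ℓ u t X v = value ℓ u t X) {p V : H}
    (hV : ∀ v', ℓ X V + inner ℝ p (v' - V) + lam / 2 * ‖v' - V‖ ^ 2 ≤ ℓ X v') :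
    ∃ n, 0 ≤ n ∧ ‖(∫ r in s..t, v r) - (t - s) • V‖ ≤ n ∧
      lam / 2 * n ^ 2 ≤ (‖gradient (value ℓ u s) X - p‖ + Λ * (t - s)) * (t - s) * n
        + (3 / 2 * D * ‖V‖ ^ 2 + 2 * Λ * ‖V‖) * (t - s) ^ 3 + D * (t - s) * n ^ 2 := by
  set τ := t - s with hτ
  have hτ0 : 0 ≤ τ := sub_nonneg.2 hs.2
  have ht : 0 ≤ t := hs.1.trans hs.2
  set g := gradient (value ℓ u s) X with hg
  have hw : Admissible t (fun r => v r - V) := hv.sub (admissible_const t V)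
  set En := ∫ r in s..t, ‖v r - V‖ ^ 2 with hEn
  have hEn0 : 0 ≤ En := intervalIntegral.integral_nonneg hs.2 fun _ _ => by positivity
  have iw := hw.intervalIntegrable_norm_sq_right hs
  have iv := hv.intervalIntegrable_right hs
  -- By Cauchy–Schwarz this dominates the integral of `v - V` over every `[r, t]` with `r ∈ [s, t]`,
  -- while `n ^ 2 = τ * En` still records the energy.
  set n := √(τ * En) with hn
  have hn0 : 0 ≤ n := Real.sqrt_nonneg _
  have hn2 : n ^ 2 = τ * En := Real.sq_sqrt (by positivity)
  have hint : ∀ r ∈ Icc s t, ∫ a in r..t, (v a - V) = (∫ a in r..t, v a) - (t - r) • V := by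
    intro r hr
    rw [intervalIntegral.integral_sub (hv.intervalIntegrable_right ⟨hs.1.trans hr.1, hr.2⟩)
      intervalIntegrable_const, intervalIntegral.integral_const]
  have hpart : ∀ r ∈ Icc s t, ‖(∫ a in r..t, v a) - (t - r) • V‖ ≤ n := by
    intro r hr
    rw [← hint r hr]
    refine Real.le_sqrt_of_sq_le ((hw.norm_integral_sq_le ⟨hs.1.trans hr.1, hr.2⟩).trans ?_)
    have h1 : ∫ a in r..t, ‖v a - V‖ ^ 2 ≤ En :=
      intervalIntegral.integral_mono_interval hr.1 hr.2 le_rfl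
        (Eventually.of_forall fun _ => by positivity) iw
    exact mul_le_mul (by linarith [hr.1]) h1
      (intervalIntegral.integral_nonneg hr.2 fun _ _ => by positivity) hτ0
  set z := (∫ r in s..t, v r) - τ • V with hz
  have hzn : ‖z‖ ≤ n := hpart s ⟨le_rfl, hs.2⟩
  refine ⟨n, hn0, hzn, ?_⟩
  have hcurve : ∀ r ∈ Icc s t, ‖curve t X v r - X‖ ≤ τ * ‖V‖ + n := by
    intro r hr
    have e : curve t X v r - X = -(((∫ a in r..t, v a) - (t - r) • V) + (t - r) • V) := by
      unfold curve; abel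
    rw [e, norm_neg]
    refine (norm_add_le _ _).trans ?_
    rw [norm_smul, Real.norm_of_nonneg (by linarith [hr.2])]
    have h1 := hpart r hr
    have h2 : (t - r) * ‖V‖ ≤ τ * ‖V‖ :=
      mul_le_mul_of_nonneg_right (by linarith [hr.1]) (norm_nonneg _)
    linarith
  have ha := value_add_integral_le_cost hℓ hu hv hs X
  rw [hmin] at ha
  have hb := value_le_add_integral hℓ hu hs X V
  rw [← hτ] at hb
  -- The value at time `s` is expanded at `X` towards the starting points of the optimal arc and of
  -- the line. The terms in `τ • V` cancel, leaving only the pairing of `g` with `z`.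
  have hgrad := abs_sub_inner_gradient_le hD hdiff X
  have hc := (abs_le.1 (hgrad (-(τ • V + z)))).1
  have hd := (abs_le.1 (hgrad (-(τ • V)))).2
  have ecs : X + -(τ • V + z) = curve t X v s := by
    unfold curve; rw [hz]; abel
  rw [ecs, norm_neg, inner_neg_right, inner_add_right] at hc
  rw [← sub_eq_add_neg, norm_neg, inner_neg_right, norm_smul, Real.norm_of_nonneg hτ0] at hd
  have he : ∫ r in s..t, ℓ (X - (t - r) • V) V ≤ ∫ r in s..t, (ℓ X V + Λ * (τ * ‖V‖)) := by
    refine intervalIntegral.integral_mono_on hs.2 ?_ intervalIntegrable_const fun r hr => ?_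
    · have : Continuous fun r : ℝ => ℓ (X - (t - r) • V) V :=
        hℓ.continuous.comp (f := fun r : ℝ => (X - (t - r) • V, V)) (by fun_prop)
      exact this.intervalIntegrable _ _
    · have h1 := (le_abs_self _).trans (hΛ (X - (t - r) • V) X V)
      rw [sub_sub_cancel_left, norm_neg, norm_smul,
        Real.norm_of_nonneg (by linarith [hr.2])] at h1
      have h2 : (t - r) * ‖V‖ ≤ τ * ‖V‖ :=
        mul_le_mul_of_nonneg_right (by linarith [hr.1]) (norm_nonneg _)
      have h3 := mul_le_mul_of_nonneg_left h2 hΛ0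
      linarith
  rw [intervalIntegral.integral_const, smul_eq_mul, ← hτ] at he
  have ic := (hℓ.intervalIntegrable_curve ht hv X).mono_set (c := s) (d := t) (by
    rw [uIcc_of_le hs.2, uIcc_of_le ht]; exact Icc_subset_Icc_left hs.1)
  have iin : IntervalIntegrable (fun r => inner ℝ p (v r - V)) volume s t := by
    have := iv.sub (intervalIntegrable_const (c := V))
    rw [intervalIntegrable_iff] at this ⊢
    exact this.const_inner p
  -- Convexity in the velocity, with the position frozen at `X` at the price of the Lipschitz
  -- constant. The pairing with `p` nearly cancels the one with `g`.
  have hf : ∫ r in s..t, (((ℓ X V - Λ * (τ * ‖V‖ + n)) + inner ℝ p (v r - V))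
      + lam / 2 * ‖v r - V‖ ^ 2) ≤ ∫ r in s..t, ℓ (curve t X v r) (v r) := by
    refine intervalIntegral.integral_mono_on hs.2
      ((intervalIntegrable_const.add iin).add (iw.const_mul _)) ic fun r hr => ?_
    have h1 := (abs_le.1 (hΛ (curve t X v r) X (v r))).1
    have h2 := hV (v r)
    have h3 := mul_le_mul_of_nonneg_left (hcurve r hr) hΛ0
    linarith
  rw [intervalIntegral.integral_add (intervalIntegrable_const.add iin) (iw.const_mul _),
    intervalIntegral.integral_add intervalIntegrable_const iin,
    intervalIntegral.integral_const, intervalIntegral.integral_const_mul, smul_eq_mul,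
    ← hτ] at hf
  have hpz : ∫ r in s..t, inner ℝ p (v r - V) = inner ℝ p z := by
    rw [hz, hτ, ← hint s ⟨le_rfl, hs.2⟩, intervalIntegral.integral_of_le hs.2,
      intervalIntegral.integral_of_le hs.2]
    refine integral_inner ?_ p
    rw [intervalIntegrable_iff_integrableOn_Ioc_of_le hs.2] at iv
    exact iv.sub (integrable_const V)
  rw [hpz] at hf
  have hgp : inner ℝ g z - inner ℝ p z ≤ ‖g - p‖ * n := by
    rw [← inner_sub_left]
    exact (real_inner_le_norm _ _).trans (mul_le_mul_of_nonneg_left hzn (norm_nonneg _))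
  have hsum : ‖τ • V + z‖ ^ 2 ≤ 2 * (τ * ‖V‖) ^ 2 + 2 * n ^ 2 := by
    have h1 : ‖τ • V + z‖ ≤ τ * ‖V‖ + n := by
      refine (norm_add_le _ _).trans ?_
      rw [norm_smul, Real.norm_of_nonneg hτ0]; linarith
    have := pow_le_pow_left₀ (norm_nonneg _) h1 2
    nlinarith [sq_nonneg (τ * ‖V‖ - n)]
  have hsum' := mul_le_mul_of_nonneg_left hsum (by positivity : 0 ≤ D / 2)
  have hfin : lam / 2 * En ≤ (‖g - p‖ + Λ * τ) * n + (3 / 2 * D * ‖V‖ ^ 2 + 2 * Λ * ‖V‖) * τ ^ 2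
      + D * n ^ 2 := by
    linarith
  -- Multiplication by `τ` turns the energy `En` into `n ^ 2`.
  have := mul_le_mul_of_nonneg_left hfin hτ0
  have e : lam / 2 * n ^ 2 = τ * (lam / 2 * En) := by rw [hn2]; ring
  rw [e]
  linarith

theorem tendsto_sqrt_remainder {α : Type*} {l : Filter α} {g : α → H} {τ : α → ℝ} {p : H}
    (hg : Tendsto g l (𝓝 p)) (hτ : Tendsto τ l (𝓝 0)) (a b Λ κ : ℝ) :
    Tendsto (fun s => √(a * (b * (‖g s - p‖ + Λ * τ s) ^ 2 + κ * τ s))) l (𝓝 0) := by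
  have h1 : Continuous fun q : H × ℝ => √(a * (b * (‖q.1 - p‖ + Λ * q.2) ^ 2 + κ * q.2)) := by
    fun_prop
  have h2 := (h1.tendsto (p, 0)).comp (hg.prodMk_nhds hτ)
  simp only [sub_self, norm_zero, mul_zero, add_zero, ne_eq, OfNat.ofNat_ne_zero,
    not_false_eq_true, zero_pow, Real.sqrt_zero] at h2
  exact h2

/-- An optimal curve has the velocity `V` at the end point when `V` is conjugate to the gradient
of the value function. -/
theorem hasDerivWithinAt_curve (hℓ : RegularRunningCost ℓ lam CL K c)
    (hu : RegularInitialCost u Ku cu)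
    (hα : ∀ t ∈ Icc 0 T, 0 < lam - 2 * t ^ 2 * c - 2 * t * cu) (ht : t ∈ Ioc 0 T)
    (hv : Admissible t v) (hmin : cost ℓ u t X v = value ℓ u t X) {V : H}
    (hV : ∀ v', ℓ X V + inner ℝ (gradient (value ℓ u t) X) (v' - V) + lam / 2 * ‖v' - V‖ ^ 2
      ≤ ℓ X v') :
    HasDerivWithinAt (curve t X v) V (Icc 0 t) t := by
  obtain ⟨D, hD0, hD⟩ := exists_abs_value_second_diff_le hℓ hu hα
  obtain ⟨Λ, hΛ0, hΛ⟩ := hℓ.lipschitz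
  have hlam := hℓ.lam_pos
  set p := gradient (value ℓ u t) X with hp
  set κ := 3 / 2 * D * ‖V‖ ^ 2 + 2 * Λ * ‖V‖ with hκ
  have hsub : Icc 0 t \ {t} ⊆ Icc 0 T := fun s hs => ⟨hs.1.1, hs.1.2.trans ht.2⟩
  -- The bound obtained by solving the quadratic inequality of `endpoint_estimate` for `n / (t -
  -- s)`.
  set F : ℝ → ℝ := fun s => √(8 / lam * (2 / lam
    * (‖gradient (value ℓ u s) X - p‖ + Λ * (t - s)) ^ 2 + κ * (t - s))) with hF
  have hFlim : Tendsto F (𝓝[Icc 0 t \ {t}] t) (𝓝 0) := by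
    have h1 : Tendsto (fun s => gradient (value ℓ u s) X) (𝓝[Icc 0 t \ {t}] t) (𝓝 p) := by
      have h2 : Tendsto (fun q : ℝ × H => gradient (value ℓ u q.1) q.2)
          (𝓝[Icc 0 T ×ˢ univ] (t, X)) (𝓝 p) :=
        continuousOn_gradient_value hℓ hu hα (t, X) ⟨⟨ht.1.le, ht.2⟩, mem_univ _⟩
      have h3 : Tendsto (fun s : ℝ => (s, X)) (𝓝[Icc 0 t \ {t}] t)
          (𝓝[Icc 0 T ×ˢ univ] (t, X)) := by
        refine tendsto_nhdsWithin_iff.2 ⟨?_, ?_⟩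
        · have : Continuous fun s : ℝ => (s, X) := by fun_prop
          exact (this.tendsto t).mono_left nhdsWithin_le_nhds
        · filter_upwards [self_mem_nhdsWithin] with s hs using ⟨hsub hs, mem_univ _⟩
      exact Tendsto.comp (f := fun s : ℝ => (s, X)) h2 h3
    have h4 : Tendsto (fun s : ℝ => t - s) (𝓝[Icc 0 t \ {t}] t) (𝓝 0) := by
      have : Continuous fun s : ℝ => t - s := by fun_prop
      simpa using (this.tendsto t).mono_left nhdsWithin_le_nhds
    exact tendsto_sqrt_remainder h1 h4 (8 / lam) (2 / lam) Λ κ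
  rw [hasDerivWithinAt_iff_tendsto_slope, tendsto_iff_norm_sub_tendsto_zero]
  refine squeeze_zero' (Eventually.of_forall fun _ => norm_nonneg _) ?_ hFlim
  have hsmall : ∀ᶠ s in 𝓝[Icc 0 t \ {t}] t, D * (t - s) < lam / 4 := by
    have h1 : Continuous fun s : ℝ => D * (t - s) := by fun_prop
    have h2 := (h1.tendsto t).mono_left (nhdsWithin_le_nhds (s := Icc 0 t \ {t}))
    exact h2.eventually_lt_const (by simpa using hlam)
  filter_upwards [self_mem_nhdsWithin, hsmall] with s hs hsm
  have hs' : s ∈ Icc 0 t := hs.1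
  have hτ : 0 < t - s := sub_pos.2 (lt_of_le_of_ne hs.1.2 (by simpa using hs.2))
  obtain ⟨n, hn0, hn, hest⟩ := endpoint_estimate hℓ hu hD0 hs' (hD s (hsub hs))
    (differentiable_value hℓ hu hα (hsub hs)) hΛ0 hΛ hv hmin hV
  have e : slope (curve t X v) t s - V = (t - s)⁻¹ • ((∫ r in s..t, v r) - (t - s) • V) := by
    rw [slope_def_module, curve_self,
      show curve t X v s - X = -∫ r in s..t, v r by unfold curve; abel, smul_neg, ← neg_smul,
      ← inv_neg, neg_sub, smul_sub, smul_smul, inv_mul_cancel₀ hτ.ne', one_smul]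
  rw [e, norm_smul, Real.norm_of_nonneg (by positivity)]
  set τ := t - s with hτdef
  have h1 : τ⁻¹ * ‖(∫ r in s..t, v r) - τ • V‖ ≤ τ⁻¹ * n := by gcongr
  refine h1.trans (Real.le_sqrt_of_sq_le ?_)
  set y := τ⁻¹ * n with hy
  have hny : n = τ * y := by rw [hy]; field_simp
  have hy0 : 0 ≤ y := by positivity
  set q := ‖gradient (value ℓ u s) X - p‖ + Λ * τ with hq
  rw [hny, ← hκ] at hest
  have h2 : τ ^ 2 * (lam / 2 * y ^ 2) ≤ τ ^ 2 * (q * y + κ * τ + D * τ * y ^ 2) := by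
    linarith
  have h3 := le_of_mul_le_mul_left h2 (by positivity)
  -- Of the coefficient `lam / 2`, a part `lam / 4` absorbs the remainder and `lam / 8` goes to
  -- Young's inequality; `lam / 8` is left.
  have h4 : D * τ * y ^ 2 ≤ lam / 4 * y ^ 2 := by gcongr
  have h5 : q * y ≤ lam / 8 * y ^ 2 + 2 / lam * q ^ 2 := by
    have h6 : 0 ≤ 2 / lam * (q - lam / 4 * y) ^ 2 := by positivity
    have h7 : 2 / lam * (q - lam / 4 * y) ^ 2
        = 2 / lam * q ^ 2 - q * y + lam / 8 * y ^ 2 := by field_simp; ring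
    linarith
  have h8 : lam / 8 * y ^ 2 ≤ 2 / lam * q ^ 2 + κ * τ := by linarith
  have h9 := mul_le_mul_of_nonneg_left h8 (by positivity : 0 ≤ 8 / lam)
  have h10 : 8 / lam * (lam / 8 * y ^ 2) = y ^ 2 := by field_simp
  linarith

end

/-! ### Pointwise estimates for the Lagrangian and its Legendre inverse -/

/-- Subtracting `m / 2 * e ^ 2` leaves a convex function on `[0, 1]`; midpoint convexity is the
claim, with `m / 4 = m * (1 / 2) ^ 2`. -/
theorem second_diff_ge_of_iteratedDeriv_two {φ : ℝ → ℝ} (hφ : ContDiff ℝ 2 φ) {m : ℝ}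
    (hm : ∀ e ∈ Icc (0 : ℝ) 1, m ≤ iteratedDeriv 2 φ e) :
    m / 4 ≤ φ 1 + φ 0 - 2 * φ (1 / 2) := by
  have hd : Differentiable ℝ φ := hφ.differentiable (by norm_num)
  have hd1 : ContDiff ℝ 1 (deriv φ) := by
    have h2 : ContDiff ℝ (1 + 1) φ := by simpa [one_add_one_eq_two] using hφ
    exact (contDiff_succ_iff_deriv.1 h2).2.2
  have hdd : Differentiable ℝ (deriv φ) := hd1.differentiable (by norm_num)
  set ψ : ℝ → ℝ := fun e => φ e - m / 2 * e ^ 2 with hψ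
  have h1 : ∀ e, HasDerivAt ψ (deriv φ e - m * e) e := fun e => by
    have := (hd e).hasDerivAt.sub ((hasDerivAt_pow 2 e).const_mul (m / 2))
    refine this.congr_deriv ?_
    simp; ring
  have h1' : deriv ψ = fun e => deriv φ e - m * e := funext fun e => (h1 e).deriv
  have h2 : ∀ e, HasDerivAt (deriv ψ) (deriv (deriv φ) e - m) e := fun e => by
    rw [h1']
    have := (hdd e).hasDerivAt.sub ((hasDerivAt_id e).const_mul m)
    exact this.congr_deriv (by simp)
  have hconv : ConvexOn ℝ (Icc 0 1) ψ := by
    refine convexOn_of_deriv2_nonneg (convex_Icc 0 1)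
      (fun e _ => (h1 e).continuousAt.continuousWithinAt)
      (fun e _ => (h1 e).differentiableAt.differentiableWithinAt)
      (fun e _ => (h2 e).differentiableAt.differentiableWithinAt) fun e he => ?_
    rw [interior_Icc] at he
    have h3 := hm e (Ioo_subset_Icc_self he)
    rw [iteratedDeriv_succ, iteratedDeriv_one] at h3
    change 0 ≤ deriv (deriv ψ) e
    rw [(h2 e).deriv]
    linarith
  have h4 := hconv.2 (left_mem_Icc.2 zero_le_one) (right_mem_Icc.2 zero_le_one)
    (by norm_num : (0 : ℝ) ≤ 1 / 2) (by norm_num : (0 : ℝ) ≤ 1 / 2) (by norm_num)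
  simp only [hψ, smul_eq_mul] at h4
  norm_num at h4 ⊢
  linarith

theorem second_diff_le_of_iteratedDeriv_two {φ : ℝ → ℝ} (hφ : ContDiff ℝ 2 φ) {M : ℝ}
    (hM : ∀ e ∈ Icc (0 : ℝ) 1, iteratedDeriv 2 φ e ≤ M) :
    φ 1 + φ 0 - 2 * φ (1 / 2) ≤ M / 4 := by
  have := second_diff_ge_of_iteratedDeriv_two (φ := -φ) (m := -M) hφ.neg fun e he => by
    rw [iteratedDeriv_neg]
    simpa using hM e he
  simp only [Pi.neg_apply] at this
  linarith

section Lagrangian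

variable {d : ℕ} {L : E d × E d → ℝ} {c₀ c₁ lam CL : ℝ}

theorem IsLagrangian.second_diff (hL : IsLagrangian L c₀ c₁ lam CL) (q v a b : E d) :
    lam * ‖b‖ ^ 2 ≤ L (q + a, v + b) + L (q - a, v - b) - 2 * L (q, v) ∧
    L (q + a, v + b) + L (q - a, v - b) - 2 * L (q, v) ≤ CL * (‖a‖ ^ 2 + ‖b‖ ^ 2) := by
  set φ : ℝ → ℝ := fun e => L ((1 - e) • (q - a) + e • (q + a), (1 - e) • (v - b) + e • (v + b))
    with hφ
  have hsm : ContDiff ℝ 2 φ := by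
    refine (hL.contDiff.of_le (by norm_num)).comp ?_
    fun_prop
  have e1 : φ 1 = L (q + a, v + b) := by simp [hφ]
  have e0 : φ 0 = L (q - a, v - b) := by simp [hφ]
  have eh : φ (1 / 2) = L (q, v) := by
    simp only [hφ]
    congr 2 <;> module
  -- The segment has half-length `(a, b)`; the resulting factor `4` cancels the `1 / 4` of the
  -- midpoint estimate.
  have en : ∀ x y : E d, ‖x + y - (x - y)‖ ^ 2 = 4 * ‖y‖ ^ 2 := fun x y => by
    rw [show x + y - (x - y) = (2 : ℝ) • y by module, norm_smul, mul_pow]; norm_num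
  have h1 := second_diff_ge_of_iteratedDeriv_two hsm
    (hL.le_second_deriv (q - a) (q + a) (v - b) (v + b))
  have h2 := second_diff_le_of_iteratedDeriv_two hsm
    (hL.second_deriv_le (q - a) (q + a) (v - b) (v + b))
  rw [e1, e0, eh, en] at h1
  rw [e1, e0, eh, en, en] at h2
  constructor <;> linarith

theorem IsLagrangian.continuous (hL : IsLagrangian L c₀ c₁ lam CL) : Continuous L :=
  hL.contDiff.continuous

theorem IsLagrangian.nonneg (hL : IsLagrangian L c₀ c₁ lam CL) (q v : E d) : 0 ≤ L (q, v) :=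
  (mul_nonneg hL.c₀_pos.le (by positivity)).trans (hL.coercive q v)

theorem IsLagrangian.differentiable (hL : IsLagrangian L c₀ c₁ lam CL) : Differentiable ℝ L :=
  hL.contDiff.differentiable (by norm_num)

theorem IsLagrangian.differentiable_left (hL : IsLagrangian L c₀ c₁ lam CL) (v : E d) :
    Differentiable ℝ fun q => L (q, v) :=
  hL.differentiable.comp (by fun_prop)

theorem IsLagrangian.differentiable_right (hL : IsLagrangian L c₀ c₁ lam CL) (q : E d) :
    Differentiable ℝ fun v => L (q, v) :=
  hL.differentiable.comp (by fun_prop)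

theorem IsLagrangian.abs_sub_le (hL : IsLagrangian L c₀ c₁ lam CL) (q q' v : E d) :
    |L (q, v) - L (q', v)| ≤ c₁ * ‖q - q'‖ := by
  have := Convex.norm_image_sub_le_of_norm_fderiv_le (𝕜 := ℝ) (f := fun q => L (q, v)) (C := c₁)
    (s := univ) (fun x _ => hL.differentiable_left v x) (fun x _ => ?_) convex_univ
    (mem_univ q') (mem_univ q)
  · simpa using this
  · have h := hL.gradient_le x v
    rwa [gradient, LinearIsometryEquiv.norm_map] at h

/-- Quadratic growth in the velocity at `q = 0` comes from the second differences; the Lipschitz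
bound in `q` does the rest. -/
theorem IsLagrangian.exists_le (hL : IsLagrangian L c₀ c₁ lam CL) :
    ∃ A, 0 ≤ A ∧ ∀ q v, L (q, v) ≤ A * (1 + ‖q‖ + ‖v‖ ^ 2) := by
  set D := fderiv ℝ (fun v => L (0, v)) 0 with hD
  have hc := hL.c₁_pos
  have h0 := hL.nonneg 0 0
  refine ⟨L (0, 0) + ‖D‖ + |CL| / 2 + c₁, by positivity, fun q v => ?_⟩
  have h1 := le_of_second_diff_le (f := fun v => L (0, v)) (C := CL) (fun v b => by
    simpa using (hL.second_diff 0 v 0 b).2) (hL.differentiable_right 0 0).hasFDerivAt v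
  rw [zero_add, ← hD] at h1
  have h2 := (le_abs_self _).trans (hL.abs_sub_le q 0 v)
  rw [sub_zero] at h2
  have h3 : D v ≤ ‖D‖ * ‖v‖ := (le_abs_self _).trans (D.le_opNorm v)
  have h4 : ‖D‖ * ‖v‖ ≤ ‖D‖ * (1 + ‖v‖ ^ 2) := by
    have : ‖v‖ ≤ 1 + ‖v‖ ^ 2 := by nlinarith [sq_nonneg (‖v‖ - 1), norm_nonneg v]
    gcongr
  have h5 : CL / 2 * ‖v‖ ^ 2 ≤ |CL| / 2 * ‖v‖ ^ 2 := by
    gcongr; exact le_abs_self CL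
  have p1 : 0 ≤ L (0, 0) * (‖q‖ + ‖v‖ ^ 2) := by positivity
  have p2 : 0 ≤ ‖D‖ * ‖q‖ := by positivity
  have p3 : 0 ≤ |CL| / 2 * (1 + ‖q‖) := by positivity
  have p4 : 0 ≤ c₁ * (1 + ‖v‖ ^ 2) := by positivity
  linarith

theorem inner_gradient_eq_fderiv (f : E d → ℝ) (v w : E d) :
    inner ℝ (gradient f v) w = fderiv ℝ f v w := by
  simp [gradient]

/-- Uniform convexity of the Lagrangian in the velocity. -/
theorem IsLagrangian.add_inner_le (hL : IsLagrangian L c₀ c₁ lam CL) (q v w : E d) :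
    L (q, v) + inner ℝ (gradient (fun v => L (q, v)) v) (w - v) + lam / 2 * ‖w - v‖ ^ 2
      ≤ L (q, w) := by
  have h := ge_of_le_second_diff (f := fun v => L (q, v)) (m := lam) (fun v b => by
    simpa using (hL.second_diff q v 0 b).1) (hL.differentiable_right q v).hasFDerivAt (w - v)
  rw [← inner_gradient_eq_fderiv, add_sub_cancel] at h
  exact h

/-- Strong monotonicity, from adding the convexity inequalities at `v` and at `w`; it makes the
inverse of the velocity gradient continuous. -/
theorem IsLagrangian.mul_norm_sub_le (hL : IsLagrangian L c₀ c₁ lam CL) (q v w : E d) :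
    lam * ‖v - w‖
      ≤ ‖gradient (fun v => L (q, v)) v - gradient (fun v => L (q, v)) w‖ := by
  rcases eq_or_ne v w with rfl | hvw
  · simp
  have h0 : 0 < ‖v - w‖ := norm_pos_iff.2 (sub_ne_zero.2 hvw)
  have h1 := hL.add_inner_le q v w
  have h2 := hL.add_inner_le q w v
  rw [← neg_sub v w, inner_neg_right, norm_neg] at h1
  have h3 := real_inner_le_norm
    (gradient (fun v => L (q, v)) v - gradient (fun v => L (q, v)) w) (v - w)
  rw [inner_sub_left] at h3
  refine le_of_mul_le_mul_right ?_ h0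
  linarith

theorem IsLagrangian.continuous_gradient (hL : IsLagrangian L c₀ c₁ lam CL) :
    Continuous fun z : E d × E d => gradient (fun v => L (z.1, v)) z.2 := by
  have h1 : ∀ z : E d × E d, fderiv ℝ (fun v => L (z.1, v)) z.2
      = (fderiv ℝ L z).comp (ContinuousLinearMap.inr ℝ (E d) (E d)) := fun z => by
    have h2 : HasFDerivAt (fun v : E d => (z.1, v)) (ContinuousLinearMap.inr ℝ (E d) (E d)) z.2 :=
      hasFDerivAt_prodMk_right z.1 z.2
    exact ((hL.differentiable z).hasFDerivAt.comp z.2 h2).fderiv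
  have h3 : Continuous (fderiv ℝ L) := hL.contDiff.continuous_fderiv (by norm_num)
  simp only [gradient, h1]
  exact (LinearIsometryEquiv.continuous _).comp (h3.clm_comp continuous_const)

/-- The solution minimizes `L (q, v) - inner ℝ p v`, which is uniformly convex and, by coercivity
and completing the square, bounded below. -/
theorem IsLagrangian.exists_gradient_eq (hL : IsLagrangian L c₀ c₁ lam CL) (q p : E d) :
    ∃ v, gradient (fun v => L (q, v)) v = p := by
  have hc₀ := hL.c₀_pos
  have hcont : Continuous fun v => L (q, v) - inner ℝ p v :=
    (hL.differentiable_right q).continuous.sub (by fun_prop)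
  obtain ⟨v, hv⟩ := exists_forall_le_of_le_second_diff hcont hL.lam_pos
    ⟨-(‖p‖ ^ 2 / (4 * c₀)), by
      rintro _ ⟨v, rfl⟩
      have h1 := hL.coercive q v
      have h2 := real_inner_le_norm p v
      have h3 : 0 ≤ c₀ * (‖v‖ - ‖p‖ / (2 * c₀)) ^ 2 := by positivity
      have h4 : c₀ * (‖v‖ - ‖p‖ / (2 * c₀)) ^ 2
          = c₀ * ‖v‖ ^ 2 - ‖p‖ * ‖v‖ + ‖p‖ ^ 2 / (4 * c₀) := by field_simp; ring
      change _ ≤ L (q, v) - inner ℝ p v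
      linarith⟩ (fun v b => by
      have := (hL.second_diff q v 0 b).1
      simp only [add_zero, sub_zero] at this
      simp only [inner_add_right, inner_sub_right]
      linarith)
  refine ⟨v, ?_⟩
  have hmin : IsLocalMin (fun v => L (q, v) - inner ℝ p v) v :=
    Eventually.of_forall hv
  have hder : HasFDerivAt (fun v => L (q, v) - inner ℝ p v)
      (fderiv ℝ (fun v => L (q, v)) v - innerSL ℝ p) v :=
    (hL.differentiable_right q v).hasFDerivAt.sub (innerSL ℝ p).hasFDerivAt
  have h0 := hmin.hasFDerivAt_eq_zero hder
  refine ext_inner_right ℝ fun w => ?_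
  rw [inner_gradient_eq_fderiv]
  have := congrArg (fun D : E d →L[ℝ] ℝ => D w) h0
  simp only [sub_apply, innerSL_apply_apply, zero_apply] at this
  linarith

/-- The velocity as a function of position and momentum. -/
theorem IsLagrangian.exists_inverse (hL : IsLagrangian L c₀ c₁ lam CL) :
    ∃ G : E d × E d → E d, Continuous G ∧ (∀ z, gradient (fun v => L (z.1, v)) (G z) = z.2) ∧
      ∃ A, 0 ≤ A ∧ ∀ z, ‖G z‖ ≤ A * (1 + ‖z.1‖ + ‖z.2‖) := by
  choose G hG using fun z : E d × E d => hL.exists_gradient_eq z.1 z.2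
  obtain ⟨A, hA0, hA⟩ := hL.exists_le
  have hlam := hL.lam_pos
  refine ⟨G, ?_, hG, (2 * A + 1) / lam, by positivity, fun z => ?_⟩
  · rw [continuous_iff_continuousAt]
    intro z
    have hb : ∀ y : E d × E d, ‖G y - G z‖
        ≤ lam⁻¹ * ‖y.2 - gradient (fun v => L (y.1, v)) (G z)‖ := fun y => by
      have := hL.mul_norm_sub_le y.1 (G y) (G z)
      rw [hG y] at this
      rwa [← div_eq_inv_mul, le_div_iff₀' hlam]
    have hc : Continuous fun y : E d × E d =>
        lam⁻¹ * ‖y.2 - gradient (fun v => L (y.1, v)) (G z)‖ := by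
      have : Continuous fun y : E d × E d => gradient (fun v => L (y.1, v)) (G z) :=
        hL.continuous_gradient.comp (f := fun y : E d × E d => (y.1, G z)) (by fun_prop)
      fun_prop
    have hl := hc.tendsto z
    rw [hG z, sub_self, norm_zero, mul_zero] at hl
    rw [ContinuousAt, tendsto_iff_norm_sub_tendsto_zero]
    exact squeeze_zero (fun _ => norm_nonneg _) hb hl
  · set g := gradient (fun v => L (z.1, v)) 0 with hg
    have h1 := hL.mul_norm_sub_le z.1 (G z) 0
    rw [hG z, sub_zero, ← hg] at h1
    -- Convexity from velocity `0` to the unit vector along `g` increases the cost by at least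
    -- `‖g‖`, and the growth bound limits it there.
    have h2 : ‖g‖ ≤ A * (2 + ‖z.1‖) := by
      rcases eq_or_ne g 0 with h0 | h0
      · rw [h0, norm_zero]; positivity
      have hgn : 0 < ‖g‖ := norm_pos_iff.2 h0
      have hn : ‖(‖g‖⁻¹ : ℝ) • g‖ = 1 := by
        rw [norm_smul, norm_inv, norm_norm, inv_mul_cancel₀ hgn.ne']
      have h3 := hL.add_inner_le z.1 0 ((‖g‖⁻¹ : ℝ) • g)
      rw [← hg, sub_zero, inner_smul_right, real_inner_self_eq_norm_sq, hn] at h3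
      have h4 := hA z.1 ((‖g‖⁻¹ : ℝ) • g)
      rw [hn] at h4
      have h5 := hL.nonneg z.1 0
      have h6 : ‖g‖⁻¹ * ‖g‖ ^ 2 = ‖g‖ := by field_simp
      linarith
    have h3 := norm_sub_le z.2 g
    rw [div_mul_eq_mul_div, le_div_iff₀' hlam]
    have p1 := norm_nonneg z.1
    have p2 := norm_nonneg z.2
    have p3 : 0 ≤ A * ‖z.2‖ := by positivity
    have p4 : 0 ≤ A * ‖z.1‖ := by positivity
    linarith

end Lagrangian

/-! ### Pointwise estimates for the interaction functions -/

section Interaction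

variable {d : ℕ} {Φ : E d → ℝ} {c : ℝ}

theorem hessianSup_nonneg (Φ : E d → ℝ) : 0 ≤ hessianSup Φ :=
  Real.iSup_nonneg fun _ => norm_nonneg _

theorem negPt_nonneg (c : ℝ) : 0 ≤ negPt c := le_max_right _ _

theorem IsInteraction.norm_le_hessianSup (hΦ : IsInteraction Φ c) (x : E d) :
    ‖iteratedFDeriv ℝ 2 Φ x‖ ≤ hessianSup Φ := by
  obtain ⟨K, hK⟩ := hΦ.bounded_derivs 2 (by norm_num)
  exact le_ciSup (f := fun x => ‖iteratedFDeriv ℝ 2 Φ x‖) ⟨K, by rintro _ ⟨x, rfl⟩; exact hK x⟩ x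

theorem iteratedDeriv_two_comp_line {f : E d → ℝ} (hf : ContDiff ℝ 2 f) (x y : E d) (e : ℝ) :
    iteratedDeriv 2 (fun e : ℝ => f (x + e • y)) e
      = iteratedFDeriv ℝ 2 f (x + e • y) ![y, y] := by
  have hline : ∀ e : ℝ, HasDerivAt (fun e : ℝ => x + e • y) y e := fun e => by
    simpa using ((hasDerivAt_id e).smul_const y).const_add x
  have h1 : ∀ e : ℝ, HasDerivAt (fun e : ℝ => f (x + e • y)) (fderiv ℝ f (x + e • y) y) e :=
    fun e => ((hf.differentiable (by norm_num) _).hasFDerivAt).comp_hasDerivAt e (hline e)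
  have h2 : Differentiable ℝ (fderiv ℝ f) :=
    (hf.fderiv_right (m := 1) (by norm_num)).differentiable (by norm_num)
  have h3 : HasDerivAt (fun e : ℝ => fderiv ℝ f (x + e • y) y)
      (fderiv ℝ (fderiv ℝ f) (x + e • y) y y) e := by
    have h4 := ((h2 (x + e • y)).hasFDerivAt).comp_hasDerivAt e (hline e)
    simpa using h4.clm_apply (hasDerivAt_const e y)
  rw [iteratedDeriv_succ, iteratedDeriv_one, funext fun e => (h1 e).deriv, h3.deriv,
    iteratedFDeriv_two_apply]
  rfl

theorem IsInteraction.second_diff (hΦ : IsInteraction Φ c) (x y : E d) :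
    -negPt c * ‖y‖ ^ 2 ≤ Φ (x + y) + Φ (x - y) - 2 * Φ x ∧
    Φ (x + y) + Φ (x - y) - 2 * Φ x ≤ hessianSup Φ * ‖y‖ ^ 2 := by
  have hsm2 : ContDiff ℝ 2 Φ := hΦ.contDiff.of_le (by norm_num)
  set φ : ℝ → ℝ := fun e => Φ ((x - y) + e • ((2 : ℝ) • y)) with hφ
  have hsm : ContDiff ℝ 2 φ := hsm2.comp (by fun_prop)
  have e1 : φ 1 = Φ (x + y) := by simp only [hφ]; congr 1; module
  have e0 : φ 0 = Φ (x - y) := by simp [hφ]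
  have eh : φ (1 / 2) = Φ x := by simp only [hφ]; congr 1; module
  have en : ‖(2 : ℝ) • y‖ ^ 2 = 4 * ‖y‖ ^ 2 := by
    rw [norm_smul, mul_pow]; norm_num
  have h1 := second_diff_ge_of_iteratedDeriv_two hsm (m := c * ‖(2 : ℝ) • y‖ ^ 2) fun e _ => by
    rw [hφ, iteratedDeriv_two_comp_line hsm2]
    exact hΦ.le_hessian _ _
  have h2 := second_diff_le_of_iteratedDeriv_two hsm (M := hessianSup Φ * ‖(2 : ℝ) • y‖ ^ 2)
    fun e _ => by
      rw [hφ, iteratedDeriv_two_comp_line hsm2]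
      refine (Real.le_norm_self _).trans ((ContinuousMultilinearMap.le_opNorm _ _).trans ?_)
      rw [Fin.prod_univ_two]
      simp only [Matrix.cons_val_zero, Matrix.cons_val_one]
      rw [← pow_two]
      exact mul_le_mul_of_nonneg_right (hΦ.norm_le_hessianSup _) (by positivity)
  rw [e1, e0, eh, en] at h1 h2
  have h3 : -negPt c * ‖y‖ ^ 2 ≤ c * ‖y‖ ^ 2 :=
    mul_le_mul_of_nonneg_right (by linarith [le_max_left (-c) 0, show negPt c = max (-c) 0 from rfl])
      (by positivity)
  constructor <;> linarith

theorem IsInteraction.exists_abs_sub_le (hΦ : IsInteraction Φ c) :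
    ∃ K, 0 ≤ K ∧ ∀ x y, |Φ x - Φ y| ≤ K * ‖x - y‖ := by
  obtain ⟨K, hK⟩ := hΦ.bounded_derivs 1 (by norm_num)
  refine ⟨K, (norm_nonneg _).trans (hK 0), fun x y => ?_⟩
  have := Convex.norm_image_sub_le_of_norm_fderiv_le (𝕜 := ℝ) (f := Φ) (C := K)
    (s := univ) (fun x _ => hΦ.contDiff.differentiable (by norm_num) x) (fun x _ => by
      simpa [norm_iteratedFDeriv_one] using hK x) convex_univ
    (mem_univ y) (mem_univ x)
  simpa using this

end Interaction

/-! ### Lifting the estimates to `L²` over the labels -/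

section

instance isProbabilityMeasure_labels : IsProbabilityMeasure labels :=
  ⟨by simp [labels]⟩

section ThreeTerms

variable {α : Type*} [MeasurableSpace α] {μ : Measure α} {f g h : α → ℝ}

theorem integral_add_sub_two_mul (hf : Integrable f μ) (hg : Integrable g μ)
    (hh : Integrable h μ) :
    ∫ a, (f a + g a - 2 * h a) ∂μ = (∫ a, f a ∂μ) + (∫ a, g a ∂μ) - 2 * ∫ a, h a ∂μ := by
  have hfg : Integrable (fun a => f a + g a) μ := hf.add hg
  rw [integral_sub hfg (hh.const_mul 2), integral_add hf hg, integral_const_mul]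

theorem integral_sub_two_mul_add (hf : Integrable f μ) (hg : Integrable g μ)
    (hh : Integrable h μ) :
    ∫ a, (f a - 2 * g a + h a) ∂μ = (∫ a, f a ∂μ) - 2 * (∫ a, g a ∂μ) + ∫ a, h a ∂μ := by
  have hfg : Integrable (fun a => f a - 2 * g a) μ := hf.sub (hg.const_mul 2)
  rw [integral_add hfg hh, integral_sub hf (hg.const_mul 2), integral_const_mul]

theorem integral_add_add (hf : Integrable f μ) (hg : Integrable g μ) (hh : Integrable h μ) :
    ∫ a, (f a + g a + h a) ∂μ = (∫ a, f a ∂μ) + (∫ a, g a ∂μ) + ∫ a, h a ∂μ := by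
  have hfg : Integrable (fun a => f a + g a) μ := hf.add hg
  rw [integral_add hfg hh, integral_add hf hg]

end ThreeTerms

variable {d : ℕ}

theorem norm_sq_eq_integral (X : HS d) : ‖X‖ ^ 2 = ∫ ω, ‖X ω‖ ^ 2 ∂labels := by
  rw [← real_inner_self_eq_norm_sq, L2.inner_def]
  simp_rw [real_inner_self_eq_norm_sq]

theorem memLp_coe (X : HS d) : MemLp X 2 labels := Lp.memLp X

theorem integrable_norm (X : HS d) : Integrable (fun ω => ‖X ω‖) labels :=
  ((memLp_coe X).integrable one_le_two).norm

theorem integrable_norm_sq (X : HS d) : Integrable (fun ω => ‖X ω‖ ^ 2) labels :=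
  (memLp_coe X).integrable_norm_pow (by norm_num)

theorem integral_norm_le (X : HS d) : ∫ ω, ‖X ω‖ ∂labels ≤ ‖X‖ := by
  have h := integral_norm_sq_le (memLp_coe X)
  rw [probReal_univ, one_mul, ← norm_sq_eq_integral] at h
  exact abs_le_of_sq_le_sq' h (norm_nonneg _) |>.2

section Interaction

variable {Φ : E d → ℝ} {K k c : ℝ}

theorem continuous_of_abs_sub_le (hΦ : ∀ x y, |Φ x - Φ y| ≤ K * ‖x - y‖) : Continuous Φ := by
  refine (LipschitzWith.of_dist_le_mul (K := K.toNNReal) fun x y => ?_).continuous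
  rw [Real.dist_eq, dist_eq_norm]
  exact (hΦ x y).trans (mul_le_mul_of_nonneg_right (Real.le_coe_toNNReal K) (norm_nonneg _))

theorem integrable_comp_sub (hΦ : ∀ x y, |Φ x - Φ y| ≤ K * ‖x - y‖) (X : HS d) (x : E d) :
    Integrable (fun ω' => Φ (x - X ω')) labels := by
  refine Integrable.mono' (g := fun ω' => |Φ x| + K * ‖X ω'‖)
    ((integrable_const _).add ((integrable_norm X).const_mul K)) ?_ ?_
  · exact ((continuous_of_abs_sub_le hΦ).comp
      (continuous_const.sub continuous_id)).comp_aestronglyMeasurable (Lp.aestronglyMeasurable X)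
  · refine Eventually.of_forall fun ω' => ?_
    have h1 := hΦ (x - X ω') x
    rw [sub_sub_cancel_left, norm_neg] at h1
    have h2 := abs_sub_abs_le_abs_sub (Φ (x - X ω')) (Φ x)
    rw [Real.norm_eq_abs]
    linarith

theorem abs_integral_comp_sub_le (hΦ : ∀ x y, |Φ x - Φ y| ≤ K * ‖x - y‖) (X Y : HS d)
    (x y : E d) :
    |(∫ ω', Φ (x - X ω') ∂labels) - ∫ ω', Φ (y - Y ω') ∂labels|
      ≤ K * (‖x - y‖ + ∫ ω', ‖(X - Y) ω'‖ ∂labels) := by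
  rw [← integral_sub (integrable_comp_sub hΦ X x) (integrable_comp_sub hΦ Y y)]
  have h1 : K * (‖x - y‖ + ∫ ω', ‖(X - Y) ω'‖ ∂labels)
      = ∫ ω', (K * ‖x - y‖ + K * ‖(X - Y) ω'‖) ∂labels := by
    rw [integral_add (integrable_const _) ((integrable_norm _).const_mul K),
      integral_const, integral_const_mul, probReal_univ, one_smul]
    ring
  rw [h1, ← Real.norm_eq_abs]
  refine norm_integral_le_of_norm_le
    ((integrable_const _).add ((integrable_norm _).const_mul K)) ?_
  filter_upwards [Lp.coeFn_sub X Y] with ω' h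
  rw [h, Pi.sub_apply, Real.norm_eq_abs, ← mul_add]
  -- The sign of `K` is not given; the Lipschitz bound forces `0 ≤ K` as soon as two distinct points
  -- are available.
  rcases eq_or_ne (x - X ω' - (y - Y ω')) 0 with h0 | h0
  · have h2 := hΦ (x - X ω') (y - Y ω')
    rw [sub_eq_zero.1 h0, sub_self, abs_zero]
    have hK : 0 ≤ K * (‖x - y‖ + ‖X ω' - Y ω'‖) := by
      rcases eq_or_ne (x - y) 0 with h3 | h3
      · have h4 : X ω' - Y ω' = 0 := by
          have : X ω' - Y ω' = (x - y) - (x - X ω' - (y - Y ω')) := by abel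
          rw [this, h0, h3, sub_zero]
        simp [h3, h4]
      · have h4 := (abs_nonneg _).trans (hΦ x y)
        have h5 := nonneg_of_mul_nonneg_left h4 (norm_pos_iff.2 h3)
        positivity
    exact hK
  · have h2 := hΦ (x - X ω') (y - Y ω')
    have hK : 0 ≤ K := nonneg_of_mul_nonneg_left ((abs_nonneg _).trans h2) (norm_pos_iff.2 h0)
    refine h2.trans (mul_le_mul_of_nonneg_left ?_ hK)
    rw [show x - X ω' - (y - Y ω') = (x - y) - (X ω' - Y ω') by abel]
    exact norm_sub_le _ _

/-- The inner integral is a Lipschitz function of the outer position, so measurability needs no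
product measure. -/
theorem integrable_integral_comp_sub (hΦ : ∀ x y, |Φ x - Φ y| ≤ K * ‖x - y‖) (X : HS d) :
    Integrable (fun ω => ∫ ω', Φ (X ω - X ω') ∂labels) labels := by
  have hself : ∫ ω', ‖(X - X) ω'‖ ∂labels = 0 := by
    rw [sub_self, ← integral_zero ℝ ℝ (μ := labels)]
    refine integral_congr_ae ?_
    filter_upwards [Lp.coeFn_zero (E := E d) (p := 2) (μ := labels)] with ω h
    rw [h, Pi.zero_apply, norm_zero]
  have hlip : ∀ x y, |(∫ ω', Φ (x - X ω') ∂labels) - ∫ ω', Φ (y - X ω') ∂labels|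
      ≤ K * ‖x - y‖ := fun x y => by
    have := abs_integral_comp_sub_le hΦ X X x y
    rwa [hself, add_zero] at this
  refine Integrable.mono' (g := fun ω => |∫ ω', Φ (0 - X ω') ∂labels| + K * ‖X ω‖)
    ((integrable_const _).add ((integrable_norm X).const_mul K)) ?_ ?_
  · exact (continuous_of_abs_sub_le hlip).comp_aestronglyMeasurable (Lp.aestronglyMeasurable X)
  · refine Eventually.of_forall fun ω => ?_
    have h1 := hlip (X ω) 0
    rw [sub_zero] at h1
    have h2 := abs_sub_abs_le_abs_sub (∫ ω', Φ (X ω - X ω') ∂labels) (∫ ω', Φ (0 - X ω') ∂labels)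
    rw [Real.norm_eq_abs]
    linarith

theorem abs_interactionCost_sub_le (hK : 0 ≤ K) (hΦ : ∀ x y, |Φ x - Φ y| ≤ K * ‖x - y‖)
    (X Y : HS d) : |interactionCost Φ X - interactionCost Φ Y| ≤ K * ‖X - Y‖ := by
  unfold interactionCost
  rw [← mul_sub, ← integral_sub (integrable_integral_comp_sub hΦ X)
    (integrable_integral_comp_sub hΦ Y), abs_mul]
  set N := ∫ ω', ‖(X - Y) ω'‖ ∂labels with hN
  have h1 : |∫ ω, ((∫ ω', Φ (X ω - X ω') ∂labels) - ∫ ω', Φ (Y ω - Y ω') ∂labels) ∂labels|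
      ≤ ∫ ω, (K * ‖(X - Y) ω‖ + K * N) ∂labels := by
    rw [← Real.norm_eq_abs]
    refine norm_integral_le_of_norm_le
      (((integrable_norm _).const_mul K).add (integrable_const _)) ?_
    filter_upwards [Lp.coeFn_sub X Y] with ω h
    rw [h, Pi.sub_apply, Real.norm_eq_abs, ← mul_add]
    exact abs_integral_comp_sub_le hΦ X Y (X ω) (Y ω)
  rw [integral_add ((integrable_norm _).const_mul K) (integrable_const _), integral_const,
    integral_const_mul, probReal_univ, one_smul, ← hN] at h1
  have h2 := mul_le_mul_of_nonneg_left (integral_norm_le (X - Y)) hK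
  rw [abs_of_pos (by norm_num : (0 : ℝ) < 1 / 2)]
  linarith

/-- The pair `(ω, ω')` is displaced by `A ω - A ω'`, whose squared norm has double integral `2 * ‖A‖
^ 2 - 2 * ‖m‖ ^ 2`, with `m` the mean of `A`. The prefactor `1 / 2` removes the `2`, and `0 ≤ k`
allows dropping the mean. -/
theorem interactionCost_second_diff_le (hk : 0 ≤ k)
    (hΦ : ∀ x y, |Φ x - Φ y| ≤ K * ‖x - y‖)
    (hsd : ∀ x y, Φ (x + y) + Φ (x - y) - 2 * Φ x ≤ k * ‖y‖ ^ 2) (X A : HS d) :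
    interactionCost Φ (X + A) + interactionCost Φ (X - A) - 2 * interactionCost Φ X
      ≤ k * ‖A‖ ^ 2 := by
  have iA : Integrable A labels := (memLp_coe A).integrable one_le_two
  set m := ∫ ω, A ω ∂labels with hm
  have i1 := integrable_integral_comp_sub hΦ (X + A)
  have i2 := integrable_integral_comp_sub hΦ (X - A)
  have i3 := integrable_integral_comp_sub hΦ X
  have hin : ∀ x a : E d, (∫ ω', Φ ((x + a) - (X + A) ω') ∂labels)
      + (∫ ω', Φ ((x - a) - (X - A) ω') ∂labels) - 2 * ∫ ω', Φ (x - X ω') ∂labels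
      ≤ k * (‖a‖ ^ 2 - 2 * inner ℝ a m + ‖A‖ ^ 2) := by
    intro x a
    have j1 := integrable_comp_sub hΦ (X + A) (x + a)
    have j2 := integrable_comp_sub hΦ (X - A) (x - a)
    have j3 := integrable_comp_sub hΦ X x
    have j4 : Integrable (fun ω' => inner ℝ a (A ω')) labels := iA.const_inner a
    have j5 := integrable_norm_sq A
    have e : k * (‖a‖ ^ 2 - 2 * inner ℝ a m + ‖A‖ ^ 2)
        = ∫ ω', k * (‖a‖ ^ 2 - 2 * inner ℝ a (A ω') + ‖A ω'‖ ^ 2) ∂labels := by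
      rw [integral_const_mul, integral_sub_two_mul_add (integrable_const _) j4 j5, integral_const,
        integral_inner iA, probReal_univ, one_smul, norm_sq_eq_integral A]
    rw [e, ← integral_add_sub_two_mul j1 j2 j3]
    refine integral_mono_ae ((j1.add j2).sub (j3.const_mul 2))
      ((((integrable_const _).sub (j4.const_mul 2)).add j5).const_mul k) ?_
    filter_upwards [Lp.coeFn_add X A, Lp.coeFn_sub X A] with ω' h1 h2
    have h3 := hsd (x - X ω') (a - A ω')
    rw [norm_sub_sq_real] at h3
    rw [h1, h2, Pi.add_apply, Pi.sub_apply,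
      show x + a - (X ω' + A ω') = x - X ω' + (a - A ω') by abel,
      show x - a - (X ω' - A ω') = x - X ω' - (a - A ω') by abel]
    exact h3
  have j4 : Integrable (fun ω => inner ℝ (A ω) m) labels := iA.inner_const m
  have j5 := integrable_norm_sq A
  have hout : ∫ ω, ((∫ ω', Φ ((X + A) ω - (X + A) ω') ∂labels)
      + (∫ ω', Φ ((X - A) ω - (X - A) ω') ∂labels) - 2 * ∫ ω', Φ (X ω - X ω') ∂labels) ∂labels
      ≤ ∫ ω, k * (‖A ω‖ ^ 2 - 2 * inner ℝ (A ω) m + ‖A‖ ^ 2) ∂labels := by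
    refine integral_mono_ae ((i1.add i2).sub (i3.const_mul 2))
      (((j5.sub (j4.const_mul 2)).add (integrable_const _)).const_mul k) ?_
    filter_upwards [Lp.coeFn_add X A, Lp.coeFn_sub X A] with ω h1 h2
    rw [h1, h2]
    exact hin (X ω) (A ω)
  have e1 : ∫ ω, inner ℝ (A ω) m ∂labels = ‖m‖ ^ 2 := by
    simp_rw [real_inner_comm m]
    rw [integral_inner iA, ← hm, real_inner_self_eq_norm_sq]
  rw [integral_add_sub_two_mul i1 i2 i3, integral_const_mul,
    integral_sub_two_mul_add j5 j4 (integrable_const _), integral_const, e1, probReal_univ,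
    one_smul, ← norm_sq_eq_integral] at hout
  have h3 : 0 ≤ k * ‖m‖ ^ 2 := by positivity
  unfold interactionCost
  linarith

theorem interactionCost_neg (Φ : E d → ℝ) (X : HS d) :
    interactionCost (fun x => -Φ x) X = -interactionCost Φ X := by
  unfold interactionCost
  simp_rw [integral_neg]
  ring

theorem IsInteraction.regularInitialCost (hΦ : IsInteraction Φ c) :
    RegularInitialCost (interactionCost Φ) (hessianSup Φ) (negPt c) where
  K_nonneg := hessianSup_nonneg Φ
  c_nonneg := negPt_nonneg c
  lower X A := by
    obtain ⟨K, hK0, hK⟩ := hΦ.exists_abs_sub_le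
    -- The lower bound is the upper bound for `-Φ`; passing to the negative part ensures a
    -- nonnegative constant.
    have := interactionCost_second_diff_le (Φ := fun x => -Φ x) (K := K) (negPt_nonneg c)
      (fun x y => by
        rw [show -Φ x - -Φ y = -(Φ x - Φ y) by ring, abs_neg]; exact hK x y)
      (fun x y => by linarith [(hΦ.second_diff x y).1]) X A
    simp only [interactionCost_neg] at this
    linarith
  upper X A := by
    obtain ⟨K, hK0, hK⟩ := hΦ.exists_abs_sub_le
    exact interactionCost_second_diff_le (hessianSup_nonneg Φ) hK
      (fun x y => (hΦ.second_diff x y).2) X A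
  lipschitz := by
    obtain ⟨K, hK0, hK⟩ := hΦ.exists_abs_sub_le
    exact ⟨K, hK0, abs_interactionCost_sub_le hK0 hK⟩
  bddBelow := by
    obtain ⟨K, hK0, hK⟩ := hΦ.exists_abs_sub_le
    obtain ⟨B, hB⟩ := hΦ.bddBelow
    refine ⟨B / 2, fun X => ?_⟩
    have h1 : ∀ ω, B ≤ ∫ ω', Φ (X ω - X ω') ∂labels := fun ω => by
      have := integral_mono (integrable_const B) (integrable_comp_sub hK X (X ω))
        fun ω' => hB (mem_range_self (X ω - X ω'))
      rwa [integral_const, probReal_univ, one_smul] at this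
    have h2 := integral_mono (integrable_const B) (integrable_integral_comp_sub hK X) h1
    rw [integral_const, probReal_univ, one_smul] at h2
    unfold interactionCost
    linarith

end Interaction

section Lagrangian

variable {L : E d × E d → ℝ} {Φ : E d → ℝ} {c₀ c₁ lam CL cΦ : ℝ}

theorem IsLagrangian.integrable (hL : IsLagrangian L c₀ c₁ lam CL) (X V : HS d) :
    Integrable (fun ω => L (X ω, V ω)) labels := by
  obtain ⟨A, hA0, hA⟩ := hL.exists_le
  refine Integrable.mono' (g := fun ω => A * (1 + ‖X ω‖ + ‖V ω‖ ^ 2))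
    ((((integrable_const _).add (integrable_norm X)).add (integrable_norm_sq V)).const_mul A)
    ?_ ?_
  · exact hL.continuous.comp_aestronglyMeasurable
      ((Lp.aestronglyMeasurable X).prodMk (Lp.aestronglyMeasurable V))
  · refine Eventually.of_forall fun ω => ?_
    rw [Real.norm_of_nonneg (hL.nonneg _ _)]
    exact hA _ _

theorem IsLagrangian.integral_second_diff (hL : IsLagrangian L c₀ c₁ lam CL) (X V A B : HS d) :
    lam * ‖B‖ ^ 2 ≤ (∫ ω, L ((X + A) ω, (V + B) ω) ∂labels)
      + (∫ ω, L ((X - A) ω, (V - B) ω) ∂labels) - 2 * ∫ ω, L (X ω, V ω) ∂labels ∧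
    (∫ ω, L ((X + A) ω, (V + B) ω) ∂labels)
      + (∫ ω, L ((X - A) ω, (V - B) ω) ∂labels) - 2 * ∫ ω, L (X ω, V ω) ∂labels
      ≤ CL * (‖A‖ ^ 2 + ‖B‖ ^ 2) := by
  have i1 := hL.integrable (X + A) (V + B)
  have i2 := hL.integrable (X - A) (V - B)
  have i3 := hL.integrable X V
  rw [← integral_add_sub_two_mul i1 i2 i3, norm_sq_eq_integral A, norm_sq_eq_integral B,
    ← integral_const_mul, ← integral_add (integrable_norm_sq A) (integrable_norm_sq B),
    ← integral_const_mul]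
  have hae : ∀ᵐ ω ∂labels, lam * ‖B ω‖ ^ 2 ≤ L ((X + A) ω, (V + B) ω) + L ((X - A) ω, (V - B) ω)
      - 2 * L (X ω, V ω) ∧ L ((X + A) ω, (V + B) ω) + L ((X - A) ω, (V - B) ω)
      - 2 * L (X ω, V ω) ≤ CL * (‖A ω‖ ^ 2 + ‖B ω‖ ^ 2) := by
    filter_upwards [Lp.coeFn_add X A, Lp.coeFn_sub X A, Lp.coeFn_add V B, Lp.coeFn_sub V B]
      with ω h1 h2 h3 h4
    rw [h1, h2, h3, h4]
    exact hL.second_diff (X ω) (V ω) (A ω) (B ω)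
  constructor
  · exact integral_mono_ae ((integrable_norm_sq B).const_mul lam)
      ((i1.add i2).sub (i3.const_mul 2)) (hae.mono fun ω h => h.1)
  · exact integral_mono_ae ((i1.add i2).sub (i3.const_mul 2))
      (((integrable_norm_sq A).add (integrable_norm_sq B)).const_mul CL)
      (hae.mono fun ω h => h.2)

theorem regularRunningCost (hL : IsLagrangian L c₀ c₁ lam CL) (hΦ : IsInteraction Φ cΦ) :
    RegularRunningCost (runningCost (d := d) L Φ) lam CL (hessianSup Φ) (negPt cΦ) where
  lam_pos := hL.lam_pos
  K_nonneg := hessianSup_nonneg Φ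
  c_nonneg := negPt_nonneg cΦ
  lower X V A B := by
    have h1 := (hL.integral_second_diff X V A B).1
    have h2 := hΦ.regularInitialCost.lower X A
    unfold runningCost
    linarith
  upper X V A B := by
    have h1 := (hL.integral_second_diff X V A B).2
    have h2 := hΦ.regularInitialCost.upper X A
    unfold runningCost
    linarith
  lipschitz := by
    obtain ⟨Λ, hΛ0, hΛ⟩ := hΦ.regularInitialCost.lipschitz
    have hc := hL.c₁_pos
    refine ⟨c₁ + Λ, by positivity, fun X Y V => ?_⟩
    have h1 : |(∫ ω, L (X ω, V ω) ∂labels) - ∫ ω, L (Y ω, V ω) ∂labels| ≤ c₁ * ‖X - Y‖ := by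
      rw [← integral_sub (hL.integrable X V) (hL.integrable Y V), ← Real.norm_eq_abs]
      refine (norm_integral_le_of_norm_le (g := fun ω => c₁ * ‖(X - Y) ω‖)
        ((integrable_norm _).const_mul c₁) ?_).trans ?_
      · filter_upwards [Lp.coeFn_sub X Y] with ω h
        rw [h, Real.norm_eq_abs]
        exact hL.abs_sub_le _ _ _
      · rw [integral_const_mul]
        exact mul_le_mul_of_nonneg_left (integral_norm_le _) hc.le
    have h2 := hΛ X Y
    unfold runningCost
    rw [abs_le] at h1 h2 ⊢
    constructor <;> linarith
  coercive := by
    obtain ⟨B, hB⟩ := hΦ.regularInitialCost.bddBelow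
    refine ⟨c₀, |B|, hL.c₀_pos, abs_nonneg B, fun X V => ?_⟩
    have h1 := integral_mono ((integrable_norm_sq V).const_mul c₀) (hL.integrable X V)
      fun ω => hL.coercive (X ω) (V ω)
    rw [integral_const_mul, ← norm_sq_eq_integral] at h1
    have h2 := hB X
    have h3 := neg_abs_le B
    unfold runningCost
    linarith
  growth := by
    obtain ⟨A, hA0, hA⟩ := hL.exists_le
    obtain ⟨Λ, hΛ0, hΛ⟩ := hΦ.regularInitialCost.lipschitz
    refine ⟨A + |interactionCost Φ (0 : HS d)| + Λ, by positivity, fun X V => ?_⟩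
    have h1 := integral_mono (hL.integrable X V)
      ((((integrable_const (1 : ℝ)).add (integrable_norm X)).add
        (integrable_norm_sq V)).const_mul A) fun ω => hA (X ω) (V ω)
    have e : ∫ ω, A * (1 + ‖X ω‖ + ‖V ω‖ ^ 2) ∂labels
        = A * (1 + (∫ ω, ‖X ω‖ ∂labels) + ‖V‖ ^ 2) := by
      rw [integral_const_mul, integral_add_add (integrable_const _) (integrable_norm X)
        (integrable_norm_sq V), integral_const, probReal_univ, one_smul, ← norm_sq_eq_integral]
    change ∫ ω, L (X ω, V ω) ∂labels ≤ ∫ ω, A * (1 + ‖X ω‖ + ‖V ω‖ ^ 2) ∂labels at h1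
    rw [e] at h1
    have h2 := mul_le_mul_of_nonneg_left (integral_norm_le X) hA0
    have h3 := (le_abs_self _).trans (hΛ X 0)
    rw [sub_zero] at h3
    have h4 := le_abs_self (interactionCost Φ (0 : HS d))
    have p1 : 0 ≤ |interactionCost Φ (0 : HS d)| * (‖X‖ + ‖V‖ ^ 2) := by positivity
    have p2 : 0 ≤ Λ * (1 + ‖V‖ ^ 2) := by positivity
    unfold runningCost
    linarith

/-- Every momentum in `ℍ` is conjugate to a velocity in `ℍ`. -/
theorem exists_conjugate_velocity (hL : IsLagrangian L c₀ c₁ lam CL) (Φ : E d → ℝ)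
    (X p : HS d) :
    ∃ V : HS d, (∀ᵐ ω ∂labels, p ω = gradient (fun v : E d => L (X ω, v)) (V ω)) ∧
      ∀ W : HS d, runningCost L Φ X V + inner ℝ p (W - V) + lam / 2 * ‖W - V‖ ^ 2
        ≤ runningCost L Φ X W := by
  obtain ⟨G, hGc, hG, A, hA0, hA⟩ := hL.exists_inverse
  -- Continuity of `G` gives measurability, and its linear growth gives square integrability.
  have hmem : MemLp (fun ω => G (X ω, p ω)) 2 labels := by
    have hb : MemLp (fun ω => A * (1 + ‖X ω‖ + ‖p ω‖)) 2 labels :=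
      (((memLp_const (1 : ℝ)).add (memLp_coe X).norm).add (memLp_coe p).norm).const_mul A
    refine hb.mono' ?_ (Eventually.of_forall fun ω => hA (X ω, p ω))
    exact hGc.comp_aestronglyMeasurable
      ((Lp.aestronglyMeasurable X).prodMk (Lp.aestronglyMeasurable p))
  set V : HS d := hmem.toLp _ with hV
  have hgrad : ∀ᵐ ω ∂labels, p ω = gradient (fun v : E d => L (X ω, v)) (V ω) := by
    filter_upwards [hmem.coeFn_toLp] with ω h
    rw [hV, h]
    exact (hG (X ω, p ω)).symm
  refine ⟨V, hgrad, fun W => ?_⟩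
  have iin : Integrable (fun ω => inner ℝ (p ω) ((W - V) ω)) labels := L2.integrable_inner p _
  have h := integral_mono_ae (μ := labels)
    (((hL.integrable X V).add iin).add ((integrable_norm_sq (W - V)).const_mul (lam / 2)))
    (hL.integrable X W) (by
      filter_upwards [hgrad, Lp.coeFn_sub W V] with ω h1 h2
      have h3 := hL.add_inner_le (X ω) (V ω) (W ω)
      simp only [Pi.add_apply]
      rw [h2, Pi.sub_apply, h1]
      exact h3)
  simp only [Pi.add_apply] at h
  rw [integral_add_add (hL.integrable X V) iin
    ((integrable_norm_sq (W - V)).const_mul (lam / 2)), integral_const_mul, ← norm_sq_eq_integral,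
    ← L2.inner_def] at h
  unfold runningCost
  linarith

end Lagrangian

end

/-! ### From absolutely continuous curves to velocities -/

section AbsolutelyContinuous

variable {d : ℕ} {L : E d × E d → ℝ} {Φ Ψ : E d → ℝ} {t : ℝ} {X : HS d}

theorem ac2_curve {v : ℝ → HS d} (hv : Admissible t v) (X : HS d) : AC2 t (curve t X v) := by
  refine ⟨v, hv, fun s hs => ?_⟩
  have ht := hs.1.trans hs.2
  have h1 : IntervalIntegrable v volume 0 s := (hv.mono hs.2).intervalIntegrable hs.1
  have h2 := hv.intervalIntegrable_right hs
  unfold curve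
  rw [← intervalIntegral.integral_add_adjacent_intervals h1 h2]
  abel

/-- By Lebesgue differentiation `deriv γ` agrees almost everywhere on `(0, t)` with the velocity, so
the two costs coincide. -/
theorem AC2.exists_velocity {γ : ℝ → HS d} (hγ : AC2 t γ) (ht : 0 ≤ t) :
    ∃ v, Admissible t v ∧ EqOn γ (curve t (γ t) v) (Icc 0 t) ∧
      totalCost L Φ Ψ t γ = cost (runningCost L Φ) (interactionCost Ψ) t (γ t) v := by
  obtain ⟨v, hv, hγv⟩ := hγ
  have hv : Admissible t v := hv
  have heq : EqOn γ (curve t (γ t) v) (Icc 0 t) := by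
    intro s hs
    have h1 : IntervalIntegrable v volume 0 s := (hv.mono hs.2).intervalIntegrable hs.1
    have h2 := hv.intervalIntegrable_right hs
    unfold curve
    rw [hγv s hs, hγv t ⟨ht, le_rfl⟩, ← intervalIntegral.integral_add_adjacent_intervals h1 h2]
    abel
  refine ⟨v, hv, heq, ?_⟩
  unfold totalCost cost
  rw [heq ⟨le_rfl, ht⟩]
  congr 1
  refine intervalIntegral.integral_congr_ae ?_
  -- Nothing is known about `γ` beyond `t`, so the two-sided derivative at `t` has to be discarded.
  have hne : ∀ᵐ s : ℝ, s ≠ t := by simp [ae_iff, measure_singleton]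
  filter_upwards [(hv.intervalIntegrable ht).ae_hasDerivAt_integral, hne] with s hs hst hmem
  rw [uIoc_of_le ht] at hmem
  rw [uIcc_of_le ht] at hs
  have hs' : s ∈ Icc 0 t := Ioc_subset_Icc_self hmem
  have hder : HasDerivAt γ (v s) s := by
    refine ((hs hs' 0 ⟨le_rfl, ht⟩).const_add (γ 0)).congr_of_eventuallyEq ?_
    filter_upwards [Icc_mem_nhds hmem.1 (lt_of_le_of_ne hmem.2 hst)] with r hr using hγv r hr
  rw [hder.deriv, heq hs']

theorem totalCost_curve {v : ℝ → HS d} (hv : Admissible t v) (ht : 0 ≤ t) (X : HS d) :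
    totalCost L Φ Ψ t (curve t X v) = cost (runningCost L Φ) (interactionCost Ψ) t X v := by
  unfold totalCost cost
  congr 1
  refine intervalIntegral.integral_congr_ae ?_
  filter_upwards [(hv.intervalIntegrable ht).ae_hasDerivAt_integral] with s hs hmem
  rw [uIoc_of_le ht] at hmem
  rw [uIcc_of_le ht] at hs
  have hder : HasDerivAt (curve t X v) (v s) s := by
    have h1 := (hs (Ioc_subset_Icc_self hmem) t ⟨ht, le_rfl⟩).const_add X
    refine h1.congr_of_eventuallyEq (Eventually.of_forall fun r => ?_)
    change X - (∫ a in r..t, v a) = X + ∫ a in t..r, v a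
    rw [intervalIntegral.integral_symm r t, sub_eq_add_neg]
  rw [hder.deriv]

theorem uhat_eq_value (L : E d × E d → ℝ) (Φ Ψ : E d → ℝ) (ht : 0 ≤ t) :
    Uhat L Φ Ψ t = value (runningCost (d := d) L Φ) (interactionCost Ψ) t := by
  funext X
  unfold Uhat value
  congr 1
  ext a
  constructor
  · rintro ⟨γ, hγ, rfl, rfl⟩
    obtain ⟨v, hv, -, hc⟩ := hγ.exists_velocity (L := L) (Φ := Φ) (Ψ := Ψ) ht
    exact ⟨v, hv, hc⟩
  · rintro ⟨v, hv, rfl⟩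
    exact ⟨curve t X v, ac2_curve hv X, curve_self t X v, (totalCost_curve hv ht X).symm⟩

end AbsolutelyContinuous

/-- The sharp Lipschitz constant needs the lower bound to be dominated by the upper one: smallness
gives `2 * (t * c + cu) ≤ lam / t`, and `lam ≤ CL` whenever some `h` is nonzero. -/
theorem abs_value_second_diff_le_div {H : Type*} [NormedAddCommGroup H] [InnerProductSpace ℝ H]
    [CompleteSpace H] {ℓ : H → H → ℝ} {u : H → ℝ} {lam CL K c Ku cu t : ℝ}
    (hℓ : RegularRunningCost ℓ lam CL K c) (hu : RegularInitialCost u Ku cu) (ht : 0 < t)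
    (hα : 0 ≤ lam - 2 * t ^ 2 * c - 2 * t * cu) (X h : H) :
    |value ℓ u t (X + h) + value ℓ u t (X - h) - 2 * value ℓ u t X|
      ≤ (t / 3 * (CL + K) + CL / t) * ‖h‖ ^ 2 := by
  have h1 := value_second_diff_le_div hℓ hu ht X h
  have h2 := value_second_diff_ge hℓ hu ht.le hα X h
  rcases eq_or_ne h 0 with rfl | h0
  · simp only [norm_zero, ne_eq, OfNat.ofNat_ne_zero, not_false_eq_true, zero_pow, mul_zero]
      at h1 h2 ⊢
    exact abs_le.2 ⟨by linarith, h1⟩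
  have hn : 0 < ‖h‖ ^ 2 := by have := norm_pos_iff.2 h0; positivity
  have hlam : lam ≤ CL := by
    have h3 := (hℓ.lower 0 0 0 h).trans (hℓ.upper 0 0 0 h)
    simp only [norm_zero, ne_eq, OfNat.ofNat_ne_zero, not_false_eq_true, zero_pow, mul_zero,
      sub_zero, zero_add, add_zero] at h3
    exact le_of_mul_le_mul_right h3 hn
  have hCL : 0 ≤ CL := hℓ.lam_pos.le.trans hlam
  have h4 : 2 * (t * c + cu) ≤ CL / t := by
    rw [le_div_iff₀ ht]; linarith
  have h5 : 0 ≤ t / 3 * (CL + K) := by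
    have := hℓ.K_nonneg
    positivity
  have h6 : 2 * (t * c + cu) * ‖h‖ ^ 2 ≤ (t / 3 * (CL + K) + CL / t) * ‖h‖ ^ 2 :=
    mul_le_mul_of_nonneg_right (by linarith) hn.le
  exact abs_le.2 ⟨by linarith, h1⟩

end MeanField

end

/-! ### The main theorem -/

open MeanField in
theorem mainTheorem5 {d : ℕ} (L : MeanField.E d × MeanField.E d → ℝ) (Φ Ψ : MeanField.E d → ℝ)
    (c₀ c₁ lam CL cΦ cΨ T : ℝ)
    (hL : MeanField.IsLagrangian L c₀ c₁ lam CL)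
    (hΦ : MeanField.IsInteraction Φ cΦ)
    (hΨ : MeanField.IsInteraction Ψ cΨ)
    (hT : 0 < T)
    (hsmall : T ^ 2 * (MeanField.negPt cΦ + 2 * MeanField.hessianSup Φ)
      + T * (MeanField.negPt cΨ + 2 * MeanField.hessianSup Ψ) < lam / 2) :
    (∀ t ∈ Icc 0 T, Differentiable ℝ (MeanField.Uhat L Φ Ψ t)) ∧
    ContinuousOn
      (fun p : ℝ × MeanField.HS d => gradient (MeanField.Uhat L Φ Ψ p.1) p.2)
      (Icc 0 T ×ˢ univ) ∧
    ∀ t ∈ Ioc 0 T,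
      (∀ X h : MeanField.HS d,
        -(2 * (t * MeanField.negPt cΦ + MeanField.negPt cΨ)) * ‖h‖ ^ 2
            ≤ MeanField.Uhat L Φ Ψ t (X + h) + MeanField.Uhat L Φ Ψ t (X - h)
              - 2 * MeanField.Uhat L Φ Ψ t X ∧
        MeanField.Uhat L Φ Ψ t (X + h) + MeanField.Uhat L Φ Ψ t (X - h)
              - 2 * MeanField.Uhat L Φ Ψ t X
            ≤ MeanField.upperConst Φ CL t * ‖h‖ ^ 2) ∧
      (∀ X Y : MeanField.HS d,
        ‖gradient (MeanField.Uhat L Φ Ψ t) X - gradient (MeanField.Uhat L Φ Ψ t) Y‖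
          ≤ MeanField.upperConst Φ CL t * ‖X - Y‖) ∧
      ∀ X : MeanField.HS d,
        (∃ γ : ℝ → MeanField.HS d, MeanField.IsMinimizer L Φ Ψ t X γ) ∧
        ∀ γ : ℝ → MeanField.HS d, MeanField.IsMinimizer L Φ Ψ t X γ →
          ∃ V : MeanField.HS d, HasDerivWithinAt γ V (Icc 0 t) t ∧
            ∀ᵐ ω ∂MeanField.labels,
              gradient (MeanField.Uhat L Φ Ψ t) X ω
                = gradient (fun v : MeanField.E d => L (X ω, v)) (V ω) := by
  have hℓ := regularRunningCost hL hΦ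
  have hu := hΨ.regularInitialCost
  -- Twice the smallness condition, after discarding the nonnegative Hessian terms and using
  -- monotonicity in `t`.
  have hα : ∀ t ∈ Icc 0 T, 0 < lam - 2 * t ^ 2 * negPt cΦ - 2 * t * negPt cΨ := by
    intro t ht
    have h1 := negPt_nonneg cΦ
    have h2 := negPt_nonneg cΨ
    have h3 : t ^ 2 * negPt cΦ ≤ T ^ 2 * negPt cΦ :=
      mul_le_mul_of_nonneg_right (pow_le_pow_left₀ ht.1 ht.2 2) h1
    have h4 : t * negPt cΨ ≤ T * negPt cΨ := mul_le_mul_of_nonneg_right ht.2 h2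
    have h5 : 0 ≤ T ^ 2 * hessianSup Φ := mul_nonneg (by positivity) (hessianSup_nonneg Φ)
    have h6 : 0 ≤ T * hessianSup Ψ := mul_nonneg hT.le (hessianSup_nonneg Ψ)
    linarith
  refine ⟨fun t ht => ?_, ?_, fun t ht => ?_⟩
  · rw [uhat_eq_value L Φ Ψ ht.1]
    exact differentiable_value hℓ hu hα ht
  · refine (continuousOn_gradient_value hℓ hu hα).congr fun p hp => ?_
    simp only [uhat_eq_value L Φ Ψ hp.1.1]
  have ht' : t ∈ Icc 0 T := Ioc_subset_Icc_self ht
  have hU := uhat_eq_value (d := d) L Φ Ψ ht.1.le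
  have hsd := abs_value_second_diff_le_div hℓ hu ht.1 (hα t ht').le
  rw [hU]
  refine ⟨fun X h => ⟨value_second_diff_ge hℓ hu ht.1.le (hα t ht').le X h,
    value_second_diff_le_div hℓ hu ht.1 X h⟩,
    norm_gradient_sub_le hsd (differentiable_value hℓ hu hα ht'), fun X => ⟨?_, ?_⟩⟩
  · obtain ⟨v, hv, hmin⟩ := exists_cost_eq_value hℓ hu ht.1.le (hα t ht') X
    refine ⟨curve t X v, ac2_curve hv X, curve_self t X v, ?_⟩
    rw [totalCost_curve hv ht.1.le, hmin, hU]
  · rintro γ ⟨hγ, rfl, hmin⟩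
    obtain ⟨v, hv, heq, hc⟩ := hγ.exists_velocity (L := L) (Φ := Φ) (Ψ := Ψ) ht.1.le
    rw [hc, hU] at hmin
    obtain ⟨V, hgrad, hV⟩ := exists_conjugate_velocity hL Φ (γ t)
      (gradient (value (runningCost L Φ) (interactionCost Ψ) t) (γ t))
    -- The minimizer agrees with its velocity curve on `[0, t]`, which suffices for the one-sided
    -- derivative.
    exact ⟨V, (hasDerivWithinAt_curve hℓ hu hα ht hv hmin hV).congr heq
      (heq ⟨ht.1.le, le_rfl⟩), hgrad⟩
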